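/- Let $f=x^2+5$, $K=\mathbb{Q}[x]/(f)$ with $\alpha$ the class of $x$, and $I=2\mathbb{Z}+(1+\alpha)\mathbb{Z}\subset K$. Let $K_1=\mathbb{Q}(\beta)=\mathbb{Q}[x]/(x^4+12x^2+16)$, regarded as an extension of $K$ via $\alpha\mapsto(\beta^3+16\beta)/8$ (we write $\alpha$ also for the image), and let $R$ be the ring of integers of $K_1$. Let $$A=\begin{pmatrix}0&1\\-5&0\end{pmatrix},\qquad B=\begin{pmatrix}-1&2\\-3&1\end{pmatrix}.$$ For a commutative ring $E$, integral $n\times n$ matrices $M,N$ are called $E$-conjugate if $C^{-1}MC=N$ for some $C\in \mathrm{GL}_n(E)$, and locally conjugate if they are $\mathbb{Z}_p$-conjugate for every prime $p$. The Hilbert class field of a number field is its maximal abelian extension unramified at all places, finite and infinite. Let $\mathcal{M}_f$ be the set of integral $2\times2$ matrices with characteristic polynomial $f$. Then: 1. $A,B\in\mathcal{M}_f$, and every matrix in $\mathcal{M}_f$ is $\mathbb{Z}$-conjugate to exactly one of $A$ and $B$. Moreover $A(1,\alpha)^t=\alpha(1,\alpha)^t$ and $B(2,1+\alpha)^t=\alpha(2,1+\alpha)^t$,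 so that $A$ corresponds to $\mathbb{Z}[\alpha]$ and $B$ to $I$. 2. $A$ and $B$ are locally conjugate. 3. $K_1$ is the Hilbert class field of $K$. 4. Let $R[\alpha]=\{(p(\alpha),p(-\alpha)) : p\in R[x]\}\subset K_1\times K_1$. The $R$-linear map $R\otimes_{\mathbb{Z}} I\to K_1\times K_1$ that sends $r\otimes q(\alpha)$, with $q\in\mathbb{Q}[x]$ and $q(\alpha)\in I$, to $(r\,q(\alpha),r\,q(-\alpha))$ is injective, and its image is the $R[\alpha]$-submodule $(2,2)R\oplus(1+\alpha,1-\alpha)R$. This $R[\alpha]$-module is not principal. 5. $A$ and $B$ are not $R$-conjugate. 6. Consequently the ring of integers of the Hilbert class field of $K$ does not solve the conjugacy extension problem for $f$: for every Hilbert class field $H$ of $K$ there are locally conjugate matrices in $\mathcal{M}_f$ that are not $\mathcal{O}_H$-conjugate. -/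

import Mathlib

open Polynomial
open scoped NumberField TensorProduct

/-! Conjugacy of integral matrices over a ring -/

/-- The set of integral `n × n` matrices `A` with characteristic polynomial
`det (x I - A) = f`. -/
def matricesWithCharpoly (n : ℕ) (f : ℤ[X]) : Set (Matrix (Fin n) (Fin n) ℤ) :=
  {A | A.charpoly = f}

/-- Integral matrices `A`, `B` are `R`-conjugate: `C⁻¹ A C = B` for some `C ∈ GL_n(R)`. -/
def ConjugateOver (R : Type*) [CommRing R] {n : ℕ} (A B : Matrix (Fin n) (Fin n) ℤ) : Prop :=
  ∃ C : GL (Fin n) R,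
    ((C⁻¹ : GL (Fin n) R) : Matrix (Fin n) (Fin n) R) * A.map (Int.castRingHom R) *
      (C : Matrix (Fin n) (Fin n) R) = B.map (Int.castRingHom R)

/-- Integral matrices are locally conjugate if they are conjugate over the `p`-adic integers
for every prime `p`. -/
def LocallyConjugate {n : ℕ} (A B : Matrix (Fin n) (Fin n) ℤ) : Prop :=
  ∀ (p : ℕ) [Fact p.Prime], ConjugateOver ℤ_[p] A B

/-- The ring `E` solves the conjugacy extension problem for all matrices with characteristic
polynomial `f`: any two of them that are locally conjugate are conjugate over `E`. -/
def SolvesConjugacyExtension (n : ℕ) (f : ℤ[X]) (E : Type*) [CommRing E] : Prop :=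
  ∀ A ∈ matricesWithCharpoly n f, ∀ B ∈ matricesWithCharpoly n f,
    LocallyConjugate A B → ConjugateOver E A B

/-! Hilbert class fields -/

/-- An extension `L / K` of number fields is abelian and unramified at all places, finite and
infinite. -/
structure IsAbelianUnramified (K L : Type*) [Field K] [NumberField K] [Field L] [NumberField L]
    [Algebra K L] : Prop where
  isAbelianGalois : IsAbelianGalois K L
  isUnramifiedAt : ∀ (P : Ideal (𝓞 L)) [P.IsPrime], P ≠ ⊥ → Algebra.IsUnramifiedAt (𝓞 K) P
  isUnramifiedAtInfinitePlaces : IsUnramifiedAtInfinitePlaces K L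

/-- `L` is the Hilbert class field of `K`: the maximal abelian unramified extension of `K`. -/
structure IsHilbertClassField (K : Type*) (L : Type) [Field K] [NumberField K] [Field L]
    [NumberField L] [Algebra K L] : Prop where
  isAbelianUnramified : IsAbelianUnramified K L
  maximal : ∀ (M : Type) [Field M] [NumberField M] [Algebra K M],
    IsAbelianUnramified K M → Nonempty (M →ₐ[K] L)

/-! The field `K = ℚ[x] / (x² + 5)` -/

theorem irreducible_sq_add_five : Irreducible (X ^ 2 + 5 : ℚ[X]) := by
  have hd : (X ^ 2 + 5 : ℚ[X]).natDegree = 2 := by compute_degree!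
  rw [Polynomial.irreducible_iff_roots_eq_zero_of_degree_le_three (by omega) (by omega)]
  rw [Multiset.eq_zero_iff_forall_notMem]
  intro x hx
  have h := Polynomial.isRoot_of_mem_roots hx
  simp [Polynomial.IsRoot] at h
  nlinarith [sq_nonneg x]

instance fact_irreducible_sq_add_five : Fact (Irreducible (X ^ 2 + 5 : ℚ[X])) :=
  ⟨irreducible_sq_add_five⟩

/-- The field `K = ℚ[x] / (x² + 5)`. -/
def QuadK : Type := AdjoinRoot (X ^ 2 + 5 : ℚ[X])

noncomputable instance field_quadK : Field QuadK :=
  inferInstanceAs (Field (AdjoinRoot (X ^ 2 + 5 : ℚ[X])))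

instance numberField_quadK : NumberField QuadK where
  to_charZero := inferInstanceAs (CharZero (AdjoinRoot (X ^ 2 + 5 : ℚ[X])))
  to_finiteDimensional := (AdjoinRoot.powerBasis irreducible_sq_add_five.ne_zero).finite

/-! The field `K₁ = ℚ[x] / (x⁴ + 12 x² + 16)` -/

theorem monic_quartic : (X ^ 4 + 12 * X ^ 2 + 16 : ℚ[X]).Monic := by
  monicity!

theorem irreducible_quartic : Irreducible (X ^ 4 + 12 * X ^ 2 + 16 : ℚ[X]) := by
  have hd : (X ^ 4 + 12 * X ^ 2 + 16 : ℚ[X]).natDegree = 4 := by compute_degree!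
  have hn1 : (X ^ 4 + 12 * X ^ 2 + 16 : ℚ[X]) ≠ 1 := by
    intro h
    rw [h] at hd
    simp at hd
  rw [monic_quartic.irreducible_iff_natDegree']
  refine ⟨hn1, fun f g hf hg hfg hmem => ?_⟩
  rw [hd, Finset.mem_Ioc] at hmem
  have hdeg : f.natDegree + g.natDegree = 4 := by rw [← hf.natDegree_mul hg, hfg, hd]
  have hc12 : (12 : ℚ[X]) = C 12 := (C_ofNat 12).symm
  have hc16 : (16 : ℚ[X]) = C 16 := (C_ofNat 16).symm
  obtain hg1 | hg2 : g.natDegree = 1 ∨ g.natDegree = 2 := by omega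
  · have hge := hg.as_sum
    rw [hg1] at hge
    simp at hge
    have he := congrArg (Polynomial.eval (-g.coeff 0)) hfg
    rw [hge] at he
    simp at he
    nlinarith [sq_nonneg (g.coeff 0), sq_nonneg (g.coeff 0 ^ 2)]
  · have hf2 : f.natDegree = 2 := by omega
    have hge := hg.as_sum
    have hfe := hf.as_sum
    rw [hg2] at hge
    rw [hf2] at hfe
    simp [Finset.sum_range_succ] at hge hfe
    set a := g.coeff 1
    set b := g.coeff 0
    set c := f.coeff 1
    set d := f.coeff 0
    have key : ∀ x : ℚ, (x ^ 2 + (d + c * x)) * (x ^ 2 + (b + a * x)) = x ^ 4 + 12 * x ^ 2 + 16 := by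
      intro x
      have he := congrArg (Polynomial.eval x) hfg
      rw [hge, hfe] at he
      simpa using he
    have k0 := key 0
    have k1 := key 1
    have k2 := key (-1)
    have k3 := key 2
    have k4 := key (-2)
    have e3 : a + c = 0 := by linarith
    have e2 : b + d + a * c = 12 := by linarith
    have e1 : a * d + b * c = 0 := by linarith
    have e0 : d * b = 16 := by linarith
    have hc : c = -a := by linarith
    rw [hc] at e2 e1
    have e1' : a * (d - b) = 0 := by linarith
    have nosq : ∀ (q : ℚ) (n : ℤ), ¬ IsSquare n → q ^ 2 ≠ n := by
      intro q n hn h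
      exact hn (Rat.isSquare_intCast_iff.mp ⟨q, by rw [← h, sq]⟩)
    rcases mul_eq_zero.mp e1' with h | h
    · rw [h] at e2
      refine nosq ((b - d) / 4) 5 (by decide +kernel) ?_
      have : b = 12 - d := by linarith
      rw [this] at e0 ⊢
      push_cast
      linarith
    · have hdb : d = b := by linarith
      rw [hdb] at e0 e2
      have : (b - 4) * (b + 4) = 0 := by linarith
      rcases mul_eq_zero.mp this with h | h
      · nlinarith [sq_nonneg a]
      · nlinarith [sq_nonneg a]

instance fact_irreducible_quartic : Fact (Irreducible (X ^ 4 + 12 * X ^ 2 + 16 : ℚ[X])) :=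
  ⟨irreducible_quartic⟩

/-- The field `K₁ = ℚ[x] / (x⁴ + 12 x² + 16)`. -/
def QuartK : Type := AdjoinRoot (X ^ 4 + 12 * X ^ 2 + 16 : ℚ[X])

noncomputable instance field_quartK : Field QuartK :=
  inferInstanceAs (Field (AdjoinRoot (X ^ 4 + 12 * X ^ 2 + 16 : ℚ[X])))

instance numberField_quartK : NumberField QuartK where
  to_charZero := inferInstanceAs (CharZero (AdjoinRoot (X ^ 4 + 12 * X ^ 2 + 16 : ℚ[X])))
  to_finiteDimensional := (AdjoinRoot.powerBasis irreducible_quartic.ne_zero).finite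

/-- The class `β` of `x` in `K₁`. -/
noncomputable def quartBeta : QuartK := AdjoinRoot.root (X ^ 4 + 12 * X ^ 2 + 16 : ℚ[X])

theorem quartBeta_eq : quartBeta ^ 4 + 12 * quartBeta ^ 2 + 16 = 0 := by
  have h := AdjoinRoot.eval₂_root (X ^ 4 + 12 * X ^ 2 + 16 : ℚ[X])
  simp only [eval₂_add, eval₂_mul, eval₂_X_pow, eval₂_ofNat] at h
  exact h

/-- The square root `α = (β³ + 16 β) / 8` of `-5` in `K₁`. -/
noncomputable def quartAlpha : QuartK := (quartBeta ^ 3 + 16 * quartBeta) / 8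

theorem quartAlpha_sq : quartAlpha ^ 2 + 5 = 0 := by
  have h := quartBeta_eq
  unfold quartAlpha
  field_simp
  linear_combination (quartBeta ^ 2 + 20) * h

/-- The embedding of `K` into `K₁` sending the class of `x` to `α`. -/
noncomputable def embPos : QuadK →+* QuartK :=
  AdjoinRoot.lift (f := (X ^ 2 + 5 : ℚ[X])) (algebraMap ℚ QuartK) quartAlpha
    (by simpa [eval₂_add] using quartAlpha_sq)

/-- The embedding of `K` into `K₁` sending the class of `x` to `-α`. -/
noncomputable def embNeg : QuadK →+* QuartK :=
  AdjoinRoot.lift (f := (X ^ 2 + 5 : ℚ[X])) (algebraMap ℚ QuartK) (-quartAlpha)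
    (by simpa [eval₂_add] using quartAlpha_sq)

/-- `K₁` as an extension of `K`, along `x ↦ α`. -/
noncomputable instance algebraQuadQuart : Algebra QuadK QuartK := embPos.toAlgebra

/-! The matrices, and the modules that belong to them -/

/-- The matrix `A`. -/
def matA : Matrix (Fin 2) (Fin 2) ℤ := !![0, 1; -5, 0]

/-- The matrix `B`. -/
def matB : Matrix (Fin 2) (Fin 2) ℤ := !![-1, 2; -3, 1]

/-- The class `α` of `x` in `K`. -/
noncomputable def quadAlpha : QuadK := AdjoinRoot.root (X ^ 2 + 5 : ℚ[X])

/-- The fractional `ℤ[α]`-ideal `I = 2 ℤ + (1 + α) ℤ` in `K`. -/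
noncomputable def idealI : Submodule ℤ QuadK := Submodule.span ℤ {2, 1 + quadAlpha}

/-- The map `K → K₁ × K₁` reading a polynomial in `α` as the same polynomial in `(α, -α)`. -/
noncomputable def diagEmb : QuadK →+* QuartK × QuartK := embPos.prod embNeg

/-- The natural `R`-linear map `R ⊗ I → K₁ × K₁`, `r ⊗ y ↦ r • diagEmb y`, for `R = 𝓞 K₁`. -/
noncomputable def tensorMap : 𝓞 QuartK ⊗[ℤ] idealI →ₗ[𝓞 QuartK] QuartK × QuartK :=
  LinearMap.liftBaseChange (𝓞 QuartK)
    (diagEmb.toAddMonoidHom.toIntLinearMap.comp idealI.subtype)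

/-- The ring `R[α] = {(p(α), p(-α)) : p ∈ R[x]}` inside `K₁ × K₁`, for `R = 𝓞 K₁`. -/
noncomputable def ringRAlpha : Subalgebra (𝓞 QuartK) (QuartK × QuartK) :=
  Algebra.adjoin (𝓞 QuartK) {(quartAlpha, -quartAlpha)}

instance isScalarTower_ringRAlpha : IsScalarTower (𝓞 QuartK) ringRAlpha (QuartK × QuartK) :=
  ⟨fun a b c => smul_mul_assoc a (b : QuartK × QuartK) c⟩

/-- The fractional `R[α]`-ideal `R ⊗ I` inside `K₁ × K₁`: the `R[α]`-module generated by the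
image of `I`. -/
noncomputable def idealRI : Submodule ringRAlpha (QuartK × QuartK) :=
  Submodule.span ringRAlpha (diagEmb '' (idealI : Set QuadK))

/-! Unramified extensions of number fields -/

section Unramified

open scoped Pointwise nonZeroDivisors

set_option linter.unusedSectionVars false

variable (K L M : Type*) [Field K] [NumberField K] [Field L] [NumberField L]
  [Field M] [NumberField M] [Algebra K L] [Algebra K M] [Algebra L M] [IsScalarTower K L M]

theorem formallyUnramified_of_forall_ne_bot
    (h : ∀ (P : Ideal (𝓞 L)) [P.IsPrime], P ≠ ⊥ → Algebra.IsUnramifiedAt (𝓞 K) P) :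
    Algebra.FormallyUnramified (𝓞 K) (𝓞 L) := by
  rw [Algebra.formallyUnramified_iff_forall]
  rintro ⟨P, hP⟩
  by_cases hb : P = ⊥
  · subst hb
    exact Algebra.isUnramifiedAt_bot
  · exact h P hb

theorem isUnramifiedAt_of_formallyUnramified [Algebra.FormallyUnramified (𝓞 K) (𝓞 L)]
    (P : Ideal (𝓞 L)) [hP : P.IsPrime] : Algebra.IsUnramifiedAt (𝓞 K) P :=
  Algebra.formallyUnramified_iff_forall.mp inferInstance ⟨P, hP⟩

theorem formallyUnramified_tower_bot [Algebra.FormallyUnramified (𝓞 K) (𝓞 M)] :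
    Algebra.FormallyUnramified (𝓞 K) (𝓞 L) := by
  refine formallyUnramified_of_forall_ne_bot K L fun P _ hP => ?_
  obtain ⟨Q, hQ, hQP⟩ := (inferInstance : Nonempty (P.primesOver (𝓞 M)))
  have := isUnramifiedAt_of_formallyUnramified K M Q
  exact Algebra.IsUnramifiedAt.of_liesOver (𝓞 K) P Q

theorem formallyUnramified_tower_top [Algebra.FormallyUnramified (𝓞 K) (𝓞 M)] :
    Algebra.FormallyUnramified (𝓞 L) (𝓞 M) :=
  Algebra.FormallyUnramified.of_restrictScalars (𝓞 K) _ _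

theorem differentIdeal_eq_top [Algebra.FormallyUnramified (𝓞 K) (𝓞 L)] :
    differentIdeal (𝓞 K) (𝓞 L) = ⊤ := by
  by_contra h
  obtain ⟨P, hP, hle⟩ := Ideal.exists_le_maximal _ h
  exact not_dvd_differentIdeal_iff.mpr (isUnramifiedAt_of_formallyUnramified K L P)
    (Ideal.dvd_iff_le.mpr hle)

theorem formallyUnramified_of_differentIdeal_eq_top (h : differentIdeal (𝓞 K) (𝓞 L) = ⊤) :
    Algebra.FormallyUnramified (𝓞 K) (𝓞 L) := by
  refine formallyUnramified_of_forall_ne_bot K L fun P hP hb => ?_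
  rw [← not_dvd_differentIdeal_iff, h, Ideal.dvd_iff_le]
  exact fun hle => hP.ne_top (top_le_iff.mp hle)

/-- In an unramified extension every nonzero Galois-stable ideal is extended from the base. -/
theorem exists_eq_map_of_smul_mem [IsGalois K L] [Algebra.FormallyUnramified (𝓞 K) (𝓞 L)]
    (J : Ideal (𝓞 L)) (hJ : J ≠ ⊥) (hs : ∀ (σ : Gal(L/K)), ∀ x ∈ J, σ • x ∈ J) :
    ∃ I : Ideal (𝓞 K), J = I.map (algebraMap (𝓞 K) (𝓞 L)) := by
  obtain ⟨n, hn⟩ : ∃ n, Ideal.absNorm J = n := ⟨_, rfl⟩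
  induction n using Nat.strong_induction_on generalizing J with
  | _ n ih =>
  by_cases htop : J = ⊤
  · exact ⟨⊤, by rw [htop, Ideal.map_top]⟩
  obtain ⟨P, hP, hJP⟩ := Ideal.exists_le_maximal J htop
  have hPb : P ≠ ⊥ := fun h => hJ (le_bot_iff.mp (h ▸ hJP))
  set p : Ideal (𝓞 K) := P.under (𝓞 K) with hp
  have hpm : p.IsMaximal := by rw [hp]; infer_instance
  set pL := p.map (algebraMap (𝓞 K) (𝓞 L)) with hpL
  have hrad : pL.IsRadical := by
    apply Algebra.FormallyUnramified.isRadical_map_isMaximal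
  have hle : J ≤ pL := by
    rw [← hrad.radical, Ideal.radical_eq_sInf, le_sInf_iff]
    rintro Q ⟨hQ : pL ≤ Q, hQp⟩
    have hQu : P.under (𝓞 K) = Q.under (𝓞 K) :=
      hpm.eq_of_le (hQp.under (𝓞 K)).ne_top (Ideal.map_le_iff_le_comap.mp hQ)
    obtain ⟨σ, rfl⟩ :=
      Algebra.IsInvariant.exists_smul_of_under_eq (𝓞 K) (𝓞 L) Gal(L/K) P Q hQu
    intro x hx
    rw [Ideal.mem_pointwise_smul_iff_inv_smul_mem]
    exact hJP (hs _ x hx)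
  obtain ⟨J', hJ'⟩ := Ideal.dvd_iff_le.mpr hle
  have hpLb : pL ≠ ⊥ := fun h => hJ (le_bot_iff.mp (h ▸ hle))
  have hJ'b : J' ≠ ⊥ := by
    rintro rfl
    exact hJ (by rw [hJ', Ideal.mul_bot])
  have hstab : ∀ σ : Gal(L/K), σ • pL = pL := fun σ => by
    rw [hpL, Ideal.pointwise_smul_def, Ideal.map_map]
    congr 1
    ext x
    simp
  have hJeq : ∀ σ : Gal(L/K), σ • J ≤ J := fun σ x hx => by
    rw [Ideal.mem_pointwise_smul_iff_inv_smul_mem] at hx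
    simpa using hs σ _ hx
  have hs' : ∀ (σ : Gal(L/K)), ∀ x ∈ J', σ • x ∈ J' := fun σ x hx => by
    have h1 : pL * (σ • J') ≤ pL * J' := by
      rw [← hJ']
      refine le_trans (le_of_eq ?_) (hJeq σ)
      rw [hJ', smul_mul', hstab]
    have h2 : J' ∣ σ • J' := (mul_dvd_mul_iff_left hpLb).mp (Ideal.dvd_iff_le.mpr h1)
    exact Ideal.dvd_iff_le.mp h2 (Ideal.smul_mem_pointwise_smul σ x J' hx)
  have hlt : Ideal.absNorm J' < n := by
    rw [← hn, hJ', map_mul]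
    have h1 : Ideal.absNorm J' ≠ 0 := Ideal.absNorm_eq_zero_iff.not.mpr hJ'b
    have h2 : Ideal.absNorm pL ≠ 0 := Ideal.absNorm_eq_zero_iff.not.mpr hpLb
    have h3 : Ideal.absNorm pL ≠ 1 := by
      rw [Ne, Ideal.absNorm_eq_one_iff]
      intro h
      have : pL ≤ P := Ideal.map_comap_le
      exact hP.ne_top (top_le_iff.mp (h ▸ this))
    have h4 : 2 ≤ Ideal.absNorm pL := by omega
    nlinarith [Nat.pos_of_ne_zero h1]
  obtain ⟨I, hI⟩ := ih _ hlt J' hJ'b hs' rfl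
  exact ⟨p * I, by rw [Ideal.map_mul, ← hI, hJ']⟩

/-- In an unramified extension the trace of integers is surjective. -/
theorem exists_trace_eq_one [Algebra.FormallyUnramified (𝓞 K) (𝓞 L)] :
    ∃ y : 𝓞 L, Algebra.intTrace (𝓞 K) (𝓞 L) y = 1 := by
  by_contra hcon
  have hI : LinearMap.range (Algebra.intTrace (𝓞 K) (𝓞 L)) ≠ ⊤ := by
    intro h
    obtain ⟨y, hy⟩ := LinearMap.range_eq_top.mp h 1
    exact hcon ⟨y, hy⟩
  obtain ⟨p, hp, hle⟩ := Ideal.exists_le_maximal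
    (LinearMap.range (Algebra.intTrace (𝓞 K) (𝓞 L)) : Ideal (𝓞 K)) hI
  have hmem : ∀ x, Algebra.intTrace (𝓞 K) (𝓞 L) x ∈ p := fun x => hle ⟨x, rfl⟩
  have htr : ∀ x : 𝓞 L, algebraMap (𝓞 K) K (Algebra.intTrace (𝓞 K) (𝓞 L) x) =
      Algebra.trace K L (x : L) := fun x => Algebra.algebraMap_intTrace (A := 𝓞 K) x
  obtain ⟨a, hap, ha0⟩ : ∃ a ∈ p, a ≠ 0 := by
    refine ⟨_, hmem 1, fun h => ?_⟩
    have h1 := htr 1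
    rw [h, map_zero, show ((1 : 𝓞 L) : L) = algebraMap K L 1 by simp,
      Algebra.trace_algebraMap] at h1
    have : (Module.finrank K L : K) ≠ 0 := Nat.cast_ne_zero.mpr Module.finrank_pos.ne'
    simp at h1
    exact this h1.symm
  obtain ⟨q, hq⟩ := Ideal.dvd_span_singleton.mpr hap
  have haK : (algebraMap (𝓞 K) K a) ≠ 0 := by simpa using ha0
  obtain ⟨b, hbq, hba⟩ : ∃ b ∈ q, b ∉ Ideal.span {a} := by
    by_contra! hall
    have hqa : q = Ideal.span {a} :=
      le_antisymm hall (by rw [hq]; exact Ideal.mul_le_right)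
    have hq0 : q ≠ 0 := by
      rw [hqa]; simpa using ha0
    have : p = 1 := by
      have h2 : p * q = 1 * q := by rw [one_mul, ← hq, hqa]
      exact mul_right_cancel₀ hq0 h2
    exact hp.ne_top (by rw [this, Ideal.one_eq_top])
  have hdual : FractionalIdeal.dual (𝓞 K) K (1 : FractionalIdeal (𝓞 L)⁰ L) = 1 := by
    have h1 := coeIdeal_differentIdeal (𝓞 K) K L (𝓞 L)
    rw [differentIdeal_eq_top, FractionalIdeal.coeIdeal_top] at h1
    rw [← inv_inv (FractionalIdeal.dual (𝓞 K) K (1 : FractionalIdeal (𝓞 L)⁰ L)), ← h1, inv_one]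
  set z : K := algebraMap (𝓞 K) K b / algebraMap (𝓞 K) K a with hz
  have hzd : algebraMap K L z ∈ FractionalIdeal.dual (𝓞 K) K (1 : FractionalIdeal (𝓞 L)⁰ L) := by
    rw [FractionalIdeal.mem_dual (one_ne_zero : (1 : FractionalIdeal (𝓞 L)⁰ L) ≠ 0)]
    intro x hx
    obtain ⟨x, rfl⟩ := (FractionalIdeal.mem_one_iff _).mp hx
    have hbx : b * Algebra.intTrace (𝓞 K) (𝓞 L) x ∈ Ideal.span {a} := by
      rw [hq, mul_comm b]
      exact Ideal.mul_mem_mul (hmem x) hbq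
    obtain ⟨c, hc⟩ := Ideal.mem_span_singleton'.mp hbx
    refine ⟨c, ?_⟩
    rw [Algebra.traceForm_apply, ← Algebra.smul_def, map_smul]
    have := htr x
    rw [← this, smul_eq_mul, hz, div_mul_eq_mul_div, ← map_mul, ← hc, map_mul,
      mul_div_cancel_right₀ _ haK]
  rw [hdual, FractionalIdeal.mem_one_iff] at hzd
  obtain ⟨w, hw⟩ := hzd
  have hzi : IsIntegral ℤ z := by
    rw [← isIntegral_algebraMap_iff (algebraMap K L).injective, ← hw]
    exact w.isIntegral_coe
  apply hba
  rw [Ideal.mem_span_singleton']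
  obtain ⟨z', hz'⟩ := (IsIntegralClosure.isIntegral_iff (A := 𝓞 K)).mp hzi
  refine ⟨z', FaithfulSMul.algebraMap_injective (𝓞 K) K ?_⟩
  rw [map_mul, hz']
  exact div_mul_cancel₀ _ haK

end Unramified

/-! Two lemmas on abelian groups with an automorphism -/

/-- If the norm of `E` is contained in `{1, m}` and squares of elements of norm one are of the form
`ε / σ ε`, where `σ` has odd prime order `p`, then `E` is `p`-divisible. -/
theorem exists_pow_eq_of_cohomology {E E₀ : Type*} [CommGroup E] [CommGroup E₀] {p : ℕ}
    (hp : p.Prime) (hp2 : p ≠ 2) (σ : Monoid.End E) (hσ : σ ^ p = 1) (N : E →* E₀)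
    (m : E) (hm : m * m = 1) (hσm : σ m = m) (hN : ∀ x, N x = 1 ∨ N x = N m)
    (H : ∀ η, N η = 1 → ∃ ε, η ^ 2 * σ ε = ε) (x : E) : ∃ y, y ^ p = x := by
  have hodd : Odd p := hp.odd_of_ne_two hp2
  have hmp : m ^ p = m := by
    obtain ⟨k, rfl⟩ := hodd
    rw [pow_succ, pow_mul, pow_two, hm, one_pow, one_mul]
  have H' : ∀ η, N η = 1 → ∃ ε, N ε = 1 ∧ η ^ 2 * σ ε = ε := by
    intro η hη
    obtain ⟨ε, hε⟩ := H η hη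
    rcases hN ε with h | h
    · exact ⟨ε, h, hε⟩
    · refine ⟨m * ε, by rw [map_mul, h, ← map_mul, hm, map_one], ?_⟩
      rw [map_mul, hσm, mul_left_comm, hε]
  let s : AddMonoid.End (Additive E) := MonoidHom.toAdditive σ
  have hs : ∀ n : ℕ, ∀ a : E, (s ^ n) (Additive.ofMul a) = Additive.ofMul ((σ ^ n) a) := by
    intro n
    induction n with
    | zero => intro a; rfl
    | succ n ih =>
      intro a
      rw [pow_succ, pow_succ]
      exact ih (σ a)
  have hsp : s ^ p = 1 := by
    ext a
    have := hs p a.toMul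
    rw [hσ] at this
    exact this
  obtain ⟨r, hr⟩ := (Commute.neg_right (Commute.one_left s)).exists_add_pow_prime_eq hp
  obtain ⟨r, hr'⟩ : ∃ r, (1 + -s) ^ p = (p : AddMonoid.End (Additive E)) * r :=
    ⟨-(s * r), by
      rw [hr, hodd.neg_pow, hsp, one_pow, add_neg_cancel, zero_add, mul_one, mul_assoc,
        neg_mul]⟩
  have hiter : ∀ k : ℕ, ∀ η, N η = 1 → ∃ ε, N ε = 1 ∧
      ((1 + -s) ^ k) (Additive.ofMul ε) = Additive.ofMul (η ^ 2 ^ k) := by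
    intro k
    induction k with
    | zero => exact fun η hη => ⟨η, hη, by simp⟩
    | succ k ih =>
      intro η hη
      obtain ⟨ε, hε, h1⟩ := ih η hη
      obtain ⟨δ, hδ, h2⟩ := H' ε hε
      refine ⟨δ, hδ, ?_⟩
      have h3 : (1 + -s) (Additive.ofMul δ) = Additive.ofMul (ε ^ 2) := by
        change Additive.ofMul δ + -(Additive.ofMul (σ δ)) = _
        nth_rewrite 1 [← h2]
        rw [ofMul_mul, add_neg_cancel_right]
      rw [pow_succ]
      change ((1 + -s) ^ k) ((1 + -s) (Additive.ofMul δ)) = _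
      rw [h3, ofMul_pow, map_nsmul, h1, ← ofMul_pow, ← pow_mul, ← pow_succ]
  have hE1 : ∀ η, N η = 1 → ∃ y, y ^ p = η := by
    intro η hη
    obtain ⟨ε, -, h⟩ := hiter p η hη
    rw [hr'] at h
    have h' : (Additive.toMul (r (Additive.ofMul ε))) ^ p = η ^ 2 ^ p := by
      have h4 : ((p : AddMonoid.End (Additive E)) * r) (Additive.ofMul ε) =
          p • (r (Additive.ofMul ε)) := by
        change (p : AddMonoid.End (Additive E)) (r (Additive.ofMul ε)) = _
        simp
      rw [h4] at h
      exact congrArg Additive.toMul h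
    have hco : IsCoprime ((2 ^ p : ℕ) : ℤ) (p : ℤ) :=
      Nat.isCoprime_iff_coprime.mpr
        (Nat.Coprime.pow_left _ ((Nat.coprime_primes Nat.prime_two hp).mpr (Ne.symm hp2)))
    obtain ⟨u, v, huv⟩ := hco
    refine ⟨(Additive.toMul (r (Additive.ofMul ε))) ^ u * η ^ v, ?_⟩
    rw [mul_pow, ← zpow_natCast, ← zpow_natCast, ← zpow_mul, ← zpow_mul, mul_comm u, zpow_mul,
      zpow_natCast, h', ← zpow_natCast, ← zpow_mul, ← zpow_add, mul_comm _ u, huv, zpow_one]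
  rcases hN x with h | h
  · exact hE1 x h
  · obtain ⟨y, hy⟩ := hE1 (m * x) (by rw [map_mul, h, ← map_mul, hm, map_one])
    exact ⟨m * y, by rw [mul_pow, hmp, hy, ← mul_assoc, hm, one_mul]⟩

/-- An index bound for squares in an abelian group with an involution with trivial cohomology. -/
theorem two_mul_index_squares_le {E E₀ : Type*} [CommGroup E] [CommGroup E₀] (ι : E₀ →* E)
    (N : E →* E₀) (σ : Monoid.End E) (hNσ : ∀ x, ι (N x) = x * σ x) (hσι : ∀ y, σ (ι y) = ι y)
    (m : E₀) (hNm : N (ι m) = 1) (hm : ι m ≠ 1)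
    (hroot : ∀ x : E, x ^ 2 = 1 → x = 1 ∨ x = ι m) (hι : Function.Injective ι)
    (H : ∀ η, N η = 1 → ∃ ε, η * σ ε = ε)
    (hfin : (powMonoidHom (α := E₀) 2).range.index ≠ 0) :
    2 * (powMonoidHom (α := E) 2).range.index ≤ (powMonoidHom (α := E₀) 2).range.index ^ 2 := by
  set S := (powMonoidHom (α := E) 2).range with hS
  set S₀ := (powMonoidHom (α := E₀) 2).range with hS₀
  have hNι : ∀ y, N (ι y) = y ^ 2 := by
    intro y
    apply hι
    rw [hNσ, hσι, map_pow, pow_two]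
  have hT : (S ⊔ ι.range).index ≤ S₀.index := by
    have h1 : ((QuotientGroup.mk' S₀).comp N).ker ≤ S ⊔ ι.range := by
      intro x hx
      rw [MonoidHom.mem_ker, MonoidHom.comp_apply, QuotientGroup.mk'_apply,
        QuotientGroup.eq_one_iff] at hx
      obtain ⟨d, hd⟩ := hx
      rw [powMonoidHom_apply] at hd
      obtain ⟨ε, hε⟩ := H (x * (ι d)⁻¹) (by rw [map_mul, map_inv, hNι, hd, mul_inv_cancel])
      have h3 : x = (ε ^ 2) * ι (d * (N ε)⁻¹) := by
        have h4 : x = ε * (σ ε)⁻¹ * ι d := by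
          nth_rewrite 1 [← hε]
          simp
        rw [map_mul, map_inv, hNσ, h4, pow_two, mul_inv]
        simp only [mul_assoc, mul_left_comm, mul_inv_cancel_left]
        simp [mul_comm]
      rw [h3]
      exact Subgroup.mul_mem_sup ⟨ε, rfl⟩ ⟨_, rfl⟩
    have h2 : ((QuotientGroup.mk' S₀).comp N).ker.index ≤ S₀.index := by
      rw [Subgroup.index_ker, Subgroup.index]
      have : Finite (E₀ ⧸ S₀) := Nat.finite_of_card_ne_zero hfin
      exact Nat.card_le_card_of_injective _ Subtype.val_injective
    have h0 : ((QuotientGroup.mk' S₀).comp N).ker.index ≠ 0 := by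
      rw [Subgroup.index_ker]
      have : Finite (E₀ ⧸ S₀) := Nat.finite_of_card_ne_zero hfin
      exact Nat.card_ne_zero.mpr ⟨⟨1⟩, inferInstance⟩
    exact (Nat.le_of_dvd (Nat.pos_of_ne_zero h0) (Subgroup.index_dvd_of_le h1)).trans h2
  have hrel : S.relIndex (S ⊔ ι.range) = (S.comap ι).index := by
    rw [sup_comm, Subgroup.relIndex_sup_right, Subgroup.index_comap]
  have hcomap : 2 * (S.comap ι).index ≤ S₀.index := by
    have hle : S₀ ≤ S.comap ι := by
      rintro _ ⟨y, rfl⟩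
      exact ⟨ι y, by simp⟩
    have hmul := Subgroup.relIndex_mul_index hle
    have hne1 : S₀.relIndex (S.comap ι) ≠ 1 := by
      rw [Ne, Subgroup.relIndex_eq_one]
      intro hle'
      obtain ⟨ε, hε⟩ := H (ι m) hNm
      have hεε : (ε ^ 2) = ι (m * N ε) := by
        rw [map_mul, hNσ]
        nth_rewrite 1 [pow_two, ← hε]
        rw [mul_assoc, mul_comm (σ ε)]
      obtain ⟨d, hd⟩ := hle' (show m * N ε ∈ S.comap ι from ⟨ε, hεε⟩)
      rw [powMonoidHom_apply] at hd
      have h5 : (ε * (ι d)⁻¹) ^ 2 = 1 := by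
        rw [mul_pow, hεε, ← hd, map_pow, inv_pow, mul_inv_cancel]
      have h6 : ∃ y, ι y = ε := by
        rcases hroot _ h5 with h | h
        · exact ⟨d, (mul_inv_eq_one.mp h).symm⟩
        · exact ⟨m * d, by rw [map_mul, ← h, inv_mul_cancel_right]⟩
      obtain ⟨y, rfl⟩ := h6
      rw [hσι, mul_eq_right] at hε
      exact hm hε
    have hne0 : S₀.relIndex (S.comap ι) ≠ 0 := fun h => hfin (by rw [← hmul, h, zero_mul])
    rw [← hmul]
    exact Nat.mul_le_mul_right _ (by omega)
  have htot := Subgroup.relIndex_mul_index (le_sup_left : S ≤ S ⊔ ι.range)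
  rw [← htot, hrel, ← mul_assoc, pow_two]
  exact Nat.mul_le_mul hcomap hT

/-! Units of rings of integers modulo squares -/

section Units

open NumberField NumberField.Units

variable (K : Type*) [Field K] [NumberField K]

theorem rank_add_one_of_isTotallyComplex [IsTotallyComplex K] {n : ℕ}
    (hn : Module.finrank ℚ K = 2 * n) : rank K + 1 = n := by
  have h := IsTotallyComplex.finrank (K := K)
  have h1 := IsTotallyComplex.nrRealPlaces_eq_zero (K := K)
  have h2 := InfinitePlace.card_eq_nrRealPlaces_add_nrComplexPlaces K
  have h3 := Fintype.card_pos (α := InfinitePlace K)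
  unfold rank
  omega

theorem exists_unit_not_pow (hr : rank K ≠ 0) {p : ℕ} (hp : p.Prime) :
    ∃ x : (𝓞 K)ˣ, ∀ y : (𝓞 K)ˣ, y ^ p ≠ x := by
  set i : Fin (rank K) := ⟨0, Nat.pos_of_ne_zero hr⟩
  refine ⟨fundSystem K i, fun y hy => ?_⟩
  obtain ⟨⟨⟨ζ, hζ⟩, f⟩, hf, -⟩ := exist_unique_eq_mul_prod K y
  have h1 : fundSystem K i = ζ ^ p * ∏ j, fundSystem K j ^ ((p : ℤ) * f j) := by
    rw [← hy, hf, mul_pow, ← Finset.prod_pow]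
    simp only [← zpow_natCast, ← zpow_mul, mul_comm]
  have h2 : fundSystem K i = 1 * ∏ j, fundSystem K j ^ ((Pi.single i 1 : Fin (rank K) → ℤ) j) := by
    rw [one_mul, Finset.prod_eq_single i] <;> simp +contextual
  have h3 := (fun_eq_repr K (pow_mem hζ p) h1).trans (fun_eq_repr K (one_mem _) h2).symm
  have h4 := congrFun h3 i
  simp only [Pi.single_eq_same] at h4
  exact hp.one_lt.ne' (by exact_mod_cast Int.eq_one_of_dvd_one (by positivity) ⟨_, h4.symm⟩)

theorem index_range_pow_two_int (r : ℕ) :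
    (powMonoidHom (α := Multiplicative (Fin r → ℤ)) 2).range.index = 2 ^ r := by
  let f : Multiplicative (Fin r → ℤ) →* Multiplicative (Fin r → ZMod 2) :=
    AddMonoidHom.toMultiplicative
      (AddMonoidHom.compLeft (Int.castAddHom (ZMod 2)) (Fin r))
  have hf : f.ker = (powMonoidHom (α := Multiplicative (Fin r → ℤ)) 2).range := by
    ext x
    constructor
    · intro hx
      have hx' : ∀ i, ((x.toAdd i : ℤ) : ZMod 2) = 0 := fun i =>
        congrFun (congrArg Multiplicative.toAdd hx) i
      choose y hy using fun i => (ZMod.intCast_zmod_eq_zero_iff_dvd _ 2).mp (hx' i)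
      refine ⟨Multiplicative.ofAdd y, ?_⟩
      apply Multiplicative.toAdd.injective
      funext i
      simp [hy i]
    · rintro ⟨y, rfl⟩
      rw [MonoidHom.mem_ker, powMonoidHom_apply, map_pow]
      apply Multiplicative.toAdd.injective
      funext i
      rw [toAdd_pow, toAdd_one, Pi.smul_apply, Pi.zero_apply, two_nsmul, CharTwo.add_self_eq_zero]
  have hsurj : Function.Surjective f := by
    intro y
    choose x hx using fun i => ZMod.intCast_surjective (y.toAdd i)
    exact ⟨Multiplicative.ofAdd x, Multiplicative.toAdd.injective (funext hx)⟩
  rw [← hf, Subgroup.index_ker, MonoidHom.range_eq_top.mpr hsurj]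
  simp

theorem index_range_pow_two_units :
    (powMonoidHom (α := (𝓞 K)ˣ) 2).range.index = 2 ^ (rank K + 1) := by
  let f : torsion K × Multiplicative (Fin (rank K) → ℤ) →* (𝓞 K)ˣ :=
    { toFun := fun z => z.1 * ∏ i, (fundSystem K i) ^ (z.2.toAdd i)
      map_one' := by simp
      map_mul' := fun a b => by
        simp only [Prod.fst_mul, Subgroup.coe_mul, Prod.snd_mul, toAdd_mul, Pi.add_apply, zpow_add,
          Finset.prod_mul_distrib]
        exact mul_mul_mul_comm _ _ _ _ }
  have hf : Function.Bijective f := by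
    constructor
    · intro a b hab
      obtain ⟨c, -, hc⟩ := exist_unique_eq_mul_prod K (f a)
      have h1 := hc (a.1, a.2.toAdd) rfl
      have h2 := hc (b.1, b.2.toAdd) hab
      have h3 := h1.trans h2.symm
      exact Prod.ext (congrArg Prod.fst h3) (Multiplicative.toAdd.injective (congrArg Prod.snd h3))
    · intro x
      obtain ⟨c, hc, -⟩ := exist_unique_eq_mul_prod K x
      exact ⟨(c.1, Multiplicative.ofAdd c.2), hc.symm⟩
  have hmap : (powMonoidHom (α := (𝓞 K)ˣ) 2).range =
      Subgroup.map f ((powMonoidHom (α := torsion K) 2).range.prod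
        (powMonoidHom (α := Multiplicative (Fin (rank K) → ℤ)) 2).range) := by
    ext x
    constructor
    · rintro ⟨y, rfl⟩
      obtain ⟨⟨a, b⟩, rfl⟩ := hf.2 y
      exact ⟨(a ^ 2, b ^ 2), ⟨⟨a, rfl⟩, ⟨b, rfl⟩⟩, by rw [powMonoidHom_apply, ← map_pow]; rfl⟩
    · rintro ⟨⟨a, b⟩, ⟨⟨a', ha⟩, ⟨b', hb⟩⟩, rfl⟩
      refine ⟨f (a', b'), ?_⟩
      rw [powMonoidHom_apply, ← map_pow]
      exact congrArg f (Prod.ext ha hb)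
  rw [hmap, Subgroup.index_map_of_bijective hf, Subgroup.index_prod, index_range_pow_two_int,
    IsCyclic.index_powMonoidHom_range, pow_succ, mul_comm]
  exact congrArg _ (Nat.gcd_eq_right_iff_dvd.mpr (even_torsionOrder K).two_dvd)

end Units

section Cyclic

set_option linter.unusedSectionVars false

variable (K L : Type) [Field K] [NumberField K] [Field L] [NumberField L] [Algebra K L]

/-- The automorphism of the unit group of `𝓞 L` induced by an automorphism of `L`. -/
noncomputable def unitsAut (g : Gal(L/K)) : Monoid.End (𝓞 L)ˣ :=
  Units.map (MulSemiringAction.toRingHom Gal(L/K) (𝓞 L) g).toMonoidHom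

theorem coe_unitsAut (g : Gal(L/K)) (x : (𝓞 L)ˣ) : ((unitsAut K L g x : 𝓞 L) : L) = g (x : 𝓞 L) :=
  rfl

theorem coe_unitsAut_pow (g : Gal(L/K)) (n : ℕ) (x : (𝓞 L)ˣ) :
    ((((unitsAut K L g) ^ n) x : 𝓞 L) : L) = (g ^ n) (x : 𝓞 L) := by
  induction n generalizing x with
  | zero => rfl
  | succ n ih =>
    rw [pow_succ, pow_succ]
    exact (ih (unitsAut K L g x))

/-- The norm map on units. -/
noncomputable def unitsNorm : (𝓞 L)ˣ →* (𝓞 K)ˣ := Units.map (RingOfIntegers.norm K)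

theorem coe_unitsNorm (x : (𝓞 L)ˣ) :
    ((unitsNorm K L x : 𝓞 K) : K) = Algebra.norm K ((x : 𝓞 L) : L) := rfl

theorem smul_mem_of_forall_mem_zpowers [FiniteDimensional K L] {g : Gal(L/K)}
    (hg : ∀ x, x ∈ Subgroup.zpowers g)
    (J : Ideal (𝓞 L)) (h : ∀ x ∈ J, g • x ∈ J) (τ : Gal(L/K)) (x : 𝓞 L) (hx : x ∈ J) :
    τ • x ∈ J := by
  obtain ⟨n, rfl⟩ := mem_powers_iff_mem_zpowers.mpr (hg τ)
  induction n with
  | zero => simpa using hx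
  | succ n ih =>
    simp only at ih ⊢
    rw [pow_succ', mul_smul]
    exact h _ ih

/-- A unit of norm one is a quotient `x / g x`, with `x` generating an ideal extended from the base. -/
theorem exists_span_eq_map_of_unitsNorm_eq_one [IsGalois K L] [IsCyclic Gal(L/K)]
    [Algebra.FormallyUnramified (𝓞 K) (𝓞 L)] {g : Gal(L/K)} (hg : ∀ x, x ∈ Subgroup.zpowers g)
    (η : (𝓞 L)ˣ) (hη : unitsNorm K L η = 1) :
    ∃ (x : 𝓞 L) (I : Ideal (𝓞 K)), x ≠ 0 ∧ (η : 𝓞 L) * g • x = x ∧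
      Ideal.span {x} = I.map (algebraMap (𝓞 K) (𝓞 L)) := by
  have h1 : Algebra.norm K ((η : 𝓞 L) : L) = 1 := by
    rw [← coe_unitsNorm, hη]; rfl
  obtain ⟨y, hy⟩ := groupCohomology.exists_div_of_norm_eq_one hg h1
  obtain ⟨d, hd0, hd⟩ := IsAlgebraic.exists_integral_multiple
    ((IsFractionRing.isAlgebraic_iff ℤ ℚ L).mpr (Algebra.IsAlgebraic.isAlgebraic (y : L)))
  obtain ⟨x, hx⟩ := (IsIntegralClosure.isIntegral_iff (A := 𝓞 L)).mp hd
  have hx0 : x ≠ 0 := by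
    rintro rfl
    rw [map_zero, eq_comm, smul_eq_zero] at hx
    exact hx.elim hd0 y.ne_zero
  have hgx : (η : 𝓞 L) * g • x = x := by
    apply FaithfulSMul.algebraMap_injective (𝓞 L) L
    have h2 : algebraMap (𝓞 L) L (g • x) = g (algebraMap (𝓞 L) L x) := rfl
    have h3 : g (y : L) ≠ 0 := by simp
    have hy' : algebraMap (𝓞 L) L (η : 𝓞 L) = y / g y := hy.symm
    rw [map_mul, h2, hx, map_zsmul, hy']
    simp only [zsmul_eq_mul]
    field_simp
  refine ⟨x, ?_⟩
  have hmem : ∀ z ∈ Ideal.span {x}, g • z ∈ Ideal.span {x} := by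
    intro z hz
    obtain ⟨w, rfl⟩ := Ideal.mem_span_singleton'.mp hz
    rw [smul_mul', Ideal.mem_span_singleton']
    refine ⟨g • w * ((η⁻¹ : (𝓞 L)ˣ) : 𝓞 L), ?_⟩
    nth_rewrite 1 [← hgx]
    rw [mul_assoc, Units.inv_mul_cancel_left]
  obtain ⟨I, hI⟩ := exists_eq_map_of_smul_mem K L (Ideal.span {x})
    (by rwa [Ne, Ideal.span_singleton_eq_bot])
    (fun σ z hz => smul_mem_of_forall_mem_zpowers K L hg _ hmem σ z hz)
  exact ⟨I, hx0, hgx, hI⟩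

theorem exists_unitsAut_of_unitsNorm_eq_one [IsGalois K L] [IsCyclic Gal(L/K)]
    [Algebra.FormallyUnramified (𝓞 K) (𝓞 L)] {g : Gal(L/K)} (hg : ∀ x, x ∈ Subgroup.zpowers g)
    {k : ℕ} (hk : ∀ I : Ideal (𝓞 K), I ≠ ⊥ → (I ^ k).IsPrincipal)
    (η : (𝓞 L)ˣ) (hη : unitsNorm K L η = 1) : ∃ ε, η ^ k * unitsAut K L g ε = ε := by
  obtain ⟨x, I, hx, hgx, hI⟩ := exists_span_eq_map_of_unitsNorm_eq_one K L hg η hη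
  have hIb : I ≠ ⊥ := by
    rintro rfl
    rw [Ideal.map_bot, Ideal.span_singleton_eq_bot] at hI
    exact hx hI
  obtain ⟨c, hc⟩ := (hk I hIb).principal
  have h1 : Ideal.span {x ^ k} = Ideal.span {algebraMap (𝓞 K) (𝓞 L) c} := by
    rw [← Ideal.span_singleton_pow, hI, ← Ideal.map_pow, hc, Ideal.submodule_span_eq,
      Ideal.map_span, Set.image_singleton]
  obtain ⟨ε, hε⟩ := Ideal.span_singleton_eq_span_singleton.mp h1.symm
  refine ⟨ε, Units.ext ?_⟩
  have hc0 : algebraMap (𝓞 K) (𝓞 L) c ≠ 0 := fun h => by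
    rw [h, zero_mul] at hε
    exact pow_ne_zero _ hx hε.symm
  apply mul_left_cancel₀ hc0
  have h2 : g • (algebraMap (𝓞 K) (𝓞 L) c * ε) = algebraMap (𝓞 K) (𝓞 L) c * g • (ε : 𝓞 L) := by
    rw [smul_mul', smul_algebraMap]
  have h3 : g • (algebraMap (𝓞 K) (𝓞 L) c * ε) = (g • x) ^ k := by rw [hε, smul_pow']
  have h4 : ((unitsAut K L g ε : (𝓞 L)ˣ) : 𝓞 L) = g • (ε : 𝓞 L) := rfl
  rw [hε, Units.val_mul, Units.val_pow_eq_pow_val, h4, mul_left_comm, ← h2, h3, ← mul_pow, hgx]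

end Cyclic

/-! Arithmetic of `K = ℚ(√-5)` -/

theorem exists_int_of_isIntegral_ratCast {F : Type*} [Field F] [CharZero F] {q : ℚ}
    (h : IsIntegral ℤ (q : F)) : ∃ n : ℤ, q = n := by
  have h1 : IsIntegral ℤ q := by
    rw [← isIntegral_algebraMap_iff (algebraMap ℚ F).injective]
    simpa using h
  obtain ⟨n, hn⟩ := IsIntegrallyClosed.isIntegral_iff.mp h1
  exact ⟨n, by simpa using hn.symm⟩

theorem quadAlpha_sq : quadAlpha ^ 2 = -5 := by
  have h := AdjoinRoot.eval₂_root (X ^ 2 + 5 : ℚ[X])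
  simp only [eval₂_add, eval₂_X_pow, eval₂_ofNat] at h
  exact eq_neg_of_add_eq_zero_left h

theorem quadK_finrank : Module.finrank ℚ QuadK = 2 := by
  have h := (AdjoinRoot.powerBasis irreducible_sq_add_five.ne_zero).finrank
  rw [AdjoinRoot.powerBasis_dim, show (X ^ 2 + 5 : ℚ[X]).natDegree = 2 by compute_degree!] at h
  rw [← h]
  congr!

theorem quadK_ext_ringHom {R : Type*} [CommRing R] {f g : QuadK →+* R}
    (h : f quadAlpha = g quadAlpha) : f = g :=
  Ideal.Quotient.ringHom_ext (Polynomial.ringHom_ext' (Subsingleton.elim _ _) h)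

/-- Complex conjugation on `ℚ(√-5)`. -/
noncomputable def quadConj : QuadK →+* QuadK :=
  AdjoinRoot.lift (f := (X ^ 2 + 5 : ℚ[X])) (algebraMap ℚ QuadK) (-quadAlpha)
    (by simp [eval₂_add, quadAlpha_sq])

theorem quadConj_alpha : quadConj quadAlpha = -quadAlpha :=
  AdjoinRoot.lift_root (f := (X ^ 2 + 5 : ℚ[X])) (i := algebraMap ℚ QuadK) _

theorem quadK_exists_rat (x : QuadK) : ∃ s t : ℚ, x = s + t * quadAlpha := by
  obtain ⟨p, rfl⟩ := AdjoinRoot.mk_surjective x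
  have key : ∀ p : ℚ[X], ∃ s t : ℚ, Polynomial.aeval quadAlpha p = (s : QuadK) + t * quadAlpha := by
    intro p
    induction p using Polynomial.induction_on with
    | C a => exact ⟨a, 0, by simp⟩
    | add p q hp hq =>
      obtain ⟨s, t, h⟩ := hp
      obtain ⟨s', t', h'⟩ := hq
      exact ⟨s + s', t + t', by rw [map_add, h, h']; push_cast; ring⟩
    | monomial n a h =>
      obtain ⟨s, t, h⟩ := h
      refine ⟨-5 * t, s, ?_⟩
      rw [pow_succ, ← mul_assoc, map_mul, h, aeval_X]
      push_cast
      linear_combination (t : QuadK) * quadAlpha_sq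
  obtain ⟨s, t, h⟩ := key p
  refine ⟨s, t, ?_⟩
  rw [← h]
  exact (AdjoinRoot.aeval_eq p).symm

theorem quadAlpha_isIntegral : IsIntegral ℤ quadAlpha :=
  ⟨X ^ 2 + C 5, by monicity!, by simp [quadAlpha_sq]⟩

theorem quadConj_apply (s t : ℚ) :
    quadConj ((s : QuadK) + t * quadAlpha) = s - t * quadAlpha := by
  rw [map_add, map_mul, quadConj_alpha, map_ratCast, map_ratCast]
  ring

theorem quadK_rat_eq {s t s' t' : ℚ} (h : (s : QuadK) + t * quadAlpha = s' + t' * quadAlpha) :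
    s = s' ∧ t = t' := by
  have h1 := congrArg quadConj h
  rw [quadConj_apply, quadConj_apply] at h1
  have hs : (s : QuadK) = s' := by linear_combination (h + h1) / 2
  have hα : quadAlpha ≠ 0 := by
    intro h0
    have := quadAlpha_sq
    rw [h0] at this
    norm_num at this
  have ht : (t : QuadK) = t' := by
    apply mul_right_cancel₀ hα
    linear_combination (h - h1) / 2
  exact ⟨by exact_mod_cast hs, by exact_mod_cast ht⟩

theorem quadK_exists_int {x : QuadK} (hx : IsIntegral ℤ x) : ∃ m n : ℤ, x = m + n * quadAlpha := by
  obtain ⟨s, t, rfl⟩ := quadK_exists_rat x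
  have hc : IsIntegral ℤ ((s : QuadK) - t * quadAlpha) := by
    rw [← quadConj_apply]
    exact map_isIntegral_int quadConj hx
  have e1 : ((2 * s : ℚ) : QuadK) = (s + t * quadAlpha) + (s - t * quadAlpha) := by
    push_cast; ring
  have e2 : ((s ^ 2 + 5 * t ^ 2 : ℚ) : QuadK) = (s + t * quadAlpha) * (s - t * quadAlpha) := by
    push_cast; linear_combination (t ^ 2 : QuadK) * quadAlpha_sq
  have e3 : ((10 * t : ℚ) : QuadK) =
      -(((s + t * quadAlpha) - (s - t * quadAlpha)) * quadAlpha) := by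
    push_cast; linear_combination (2 * t : QuadK) * quadAlpha_sq
  obtain ⟨a, ha⟩ := exists_int_of_isIntegral_ratCast (e1 ▸ hx.add hc)
  obtain ⟨b, hb⟩ := exists_int_of_isIntegral_ratCast (e2 ▸ hx.mul hc)
  obtain ⟨c, hc'⟩ :=
    exists_int_of_isIntegral_ratCast (e3 ▸ ((hx.sub hc).mul quadAlpha_isIntegral).neg)
  have h1 : (5 * a ^ 2 + c ^ 2 : ℤ) = 20 * b := by
    have : (5 * a ^ 2 + c ^ 2 : ℚ) = 20 * b := by rw [← ha, ← hb, ← hc']; ring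
    exact_mod_cast this
  obtain ⟨c', rfl⟩ : (5 : ℤ) ∣ c := by
    have : (5 : ℤ) ∣ c ^ 2 := ⟨4 * b - a ^ 2, by linarith⟩
    exact Int.Prime.dvd_pow' (by norm_num) this
  have h2 : a ^ 2 + 5 * c' ^ 2 = 4 * b := by linarith
  have ha2 : 2 ∣ a ∧ 2 ∣ c' := by
    have h3 : (a ^ 2 + 5 * c' ^ 2) % 4 = 0 := by omega
    rcases Int.emod_two_eq_zero_or_one a with h | h <;>
    rcases Int.emod_two_eq_zero_or_one c' with h' | h'
    · exact ⟨by omega, by omega⟩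
    all_goals
      exfalso
      obtain ⟨k, hk⟩ : ∃ k, a = 2 * k + a % 2 := ⟨a / 2, by omega⟩
      obtain ⟨l, hl⟩ : ∃ l, c' = 2 * l + c' % 2 := ⟨c' / 2, by omega⟩
      rw [h] at hk
      rw [h'] at hl
      rw [hk, hl] at h3
      ring_nf at h3
      omega
  obtain ⟨⟨m, rfl⟩, ⟨n, rfl⟩⟩ := ha2
  refine ⟨m, n, ?_⟩
  have hs : s = m := by push_cast at ha; linarith
  have ht : t = n := by push_cast at hc'; linarith
  rw [hs, ht]
  push_cast
  ring

/-- `√-5` as an algebraic integer. -/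
noncomputable def intAlpha : 𝓞 QuadK := ⟨quadAlpha, quadAlpha_isIntegral⟩

@[simp]
theorem coe_intAlpha : algebraMap (𝓞 QuadK) QuadK intAlpha = quadAlpha := rfl

theorem intAlpha_sq : intAlpha ^ 2 = -5 := by
  apply FaithfulSMul.algebraMap_injective (𝓞 QuadK) QuadK
  rw [map_pow, map_neg, map_ofNat, coe_intAlpha, quadAlpha_sq]

theorem quadK_integer_eq (x : 𝓞 QuadK) : ∃ m n : ℤ, x = m + n * intAlpha := by
  obtain ⟨m, n, h⟩ := quadK_exists_int x.isIntegral_coe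
  refine ⟨m, n, FaithfulSMul.algebraMap_injective (𝓞 QuadK) QuadK ?_⟩
  rw [map_add, map_mul, map_intCast, map_intCast, coe_intAlpha]
  exact h

theorem quadK_integer_inj {m n m' n' : ℤ}
    (h : (m : 𝓞 QuadK) + n * intAlpha = m' + n' * intAlpha) : m = m' ∧ n = n' := by
  have h1 := congrArg (algebraMap (𝓞 QuadK) QuadK) h
  simp only [map_add, map_mul, map_intCast] at h1
  have := quadK_rat_eq (s := m) (t := n) (s' := m') (t' := n') (by push_cast; exact h1)
  exact ⟨by exact_mod_cast this.1, by exact_mod_cast this.2⟩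

theorem quadK_unit_eq (u : (𝓞 QuadK)ˣ) : u = 1 ∨ u = -1 := by
  obtain ⟨m, n, h⟩ := quadK_integer_eq u
  obtain ⟨m', n', h'⟩ := quadK_integer_eq ((u⁻¹ : (𝓞 QuadK)ˣ) : 𝓞 QuadK)
  have h1 : ((m * m' - 5 * (n * n') : ℤ) : 𝓞 QuadK) + ((m * n' + n * m' : ℤ)) * intAlpha =
      ((1 : ℤ) : 𝓞 QuadK) + ((0 : ℤ)) * intAlpha := by
    have := u.mul_inv
    rw [h, h'] at this
    push_cast
    linear_combination this + (n : 𝓞 QuadK) * n' * intAlpha_sq * (-1)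
  obtain ⟨h2, h3⟩ := quadK_integer_inj h1
  have h4 : (m ^ 2 + 5 * n ^ 2) * (m' ^ 2 + 5 * n' ^ 2) = 1 := by
    linear_combination (m * m' - 5 * (n * n') + 1) * h2 + 5 * (m * n' + n * m') * h3
  have h5 : m ^ 2 + 5 * n ^ 2 = 1 := Int.eq_one_of_mul_eq_one_right (by positivity) h4
  have hn : n = 0 := by
    by_contra hn
    have : 0 < n ^ 2 := by positivity
    nlinarith [sq_nonneg m]
  subst hn
  have hm : m = 1 ∨ m = -1 := by
    have : (m - 1) * (m + 1) = 0 := by linarith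
    rcases mul_eq_zero.mp this with h | h
    · left; omega
    · right; omega
  rcases hm with rfl | rfl
  · left; ext; simp [h]
  · right; ext; simp [h]

theorem isTotallyComplex_of_sq_eq_neg {F : Type*} [Field F] {x : F} {n : ℕ} (hn : 0 < n)
    (hx : x ^ 2 = -(n : F)) : NumberField.IsTotallyComplex F where
  isComplex v := by
    rw [← NumberField.InfinitePlace.not_isReal_iff_isComplex,
      NumberField.InfinitePlace.isReal_iff]
    intro h
    have h1 : (v.embedding x) ^ 2 = -(n : ℂ) := by rw [← map_pow, hx, map_neg, map_natCast]
    have h2 : ((h.embedding x : ℝ) : ℂ) = v.embedding x := h.coe_embedding_apply x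
    rw [← h2] at h1
    have h3 : (h.embedding x) ^ 2 = -(n : ℝ) := by exact_mod_cast h1
    have h4 : (0 : ℝ) < n := by exact_mod_cast hn
    nlinarith [sq_nonneg (h.embedding x)]

instance quadK_isTotallyComplex : NumberField.IsTotallyComplex QuadK :=
  isTotallyComplex_of_sq_eq_neg (x := quadAlpha) (n := 5) (by norm_num)
    (by rw [quadAlpha_sq]; norm_num)

/-! Arithmetic of `K₁ = ℚ(i, √5)` -/

/-- The element `i` of `K₁`. -/
noncomputable def quartI : QuartK := -(quartBeta ^ 3 + 8 * quartBeta) / 8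

/-- The golden ratio in `K₁`. -/
noncomputable def quartPhi : QuartK := -(quartBeta ^ 2 + 4) / 4

theorem quartI_sq : quartI ^ 2 = -1 := by
  unfold quartI
  field_simp
  linear_combination (quartBeta ^ 2 + 4) * quartBeta_eq

theorem quartPhi_sq : quartPhi ^ 2 = quartPhi + 1 := by
  unfold quartPhi
  field_simp
  linear_combination quartBeta_eq

theorem quartBeta_eq_I_mul_Phi : quartBeta = 2 * quartI * quartPhi := by
  unfold quartI quartPhi
  field_simp
  linear_combination (-2 * quartBeta) * quartBeta_eq

theorem quartAlpha_eq : quartAlpha = quartI * (2 * quartPhi - 1) := by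
  unfold quartAlpha quartI quartPhi
  field_simp
  linear_combination (-2 * quartBeta) * quartBeta_eq

theorem quartK_finrank : Module.finrank ℚ QuartK = 4 := by
  have h := (AdjoinRoot.powerBasis irreducible_quartic.ne_zero).finrank
  rw [AdjoinRoot.powerBasis_dim,
    show (X ^ 4 + 12 * X ^ 2 + 16 : ℚ[X]).natDegree = 4 by compute_degree!] at h
  rw [← h]
  congr!

/-- The automorphism of `K₁` with `i ↦ -i` and `√5 ↦ √5`. -/
noncomputable def quartConj : QuartK →+* QuartK :=
  AdjoinRoot.lift (f := (X ^ 4 + 12 * X ^ 2 + 16 : ℚ[X])) (algebraMap ℚ QuartK) (-quartBeta)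
    (by
      simp only [eval₂_add, eval₂_mul, eval₂_X_pow, eval₂_ofNat]
      linear_combination quartBeta_eq)

/-- The automorphism of `K₁` with `i ↦ i` and `√5 ↦ -√5`. -/
noncomputable def quartTau : QuartK →+* QuartK :=
  AdjoinRoot.lift (f := (X ^ 4 + 12 * X ^ 2 + 16 : ℚ[X])) (algebraMap ℚ QuartK)
    (2 * quartI * (1 - quartPhi))
    (by
      simp only [eval₂_add, eval₂_mul, eval₂_X_pow, eval₂_ofNat]
      have h1 : (2 * quartI * (1 - quartPhi)) ^ 2 = -4 * (2 - quartPhi) := by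
        linear_combination 4 * (1 - quartPhi) ^ 2 * quartI_sq - 4 * quartPhi_sq
      linear_combination ((2 * quartI * (1 - quartPhi)) ^ 2 + (-4 * (2 - quartPhi)) + 12) * h1 +
        16 * quartPhi_sq)

theorem quartConj_beta : quartConj quartBeta = -quartBeta :=
  AdjoinRoot.lift_root (f := (X ^ 4 + 12 * X ^ 2 + 16 : ℚ[X])) (i := algebraMap ℚ QuartK) _

theorem quartTau_beta : quartTau quartBeta = 2 * quartI * (1 - quartPhi) :=
  AdjoinRoot.lift_root (f := (X ^ 4 + 12 * X ^ 2 + 16 : ℚ[X])) (i := algebraMap ℚ QuartK) _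

theorem quartConj_I : quartConj quartI = -quartI := by
  unfold quartI
  simp only [map_div₀, map_neg, map_add, map_mul, map_pow, map_ofNat, quartConj_beta]
  ring

theorem quartConj_Phi : quartConj quartPhi = quartPhi := by
  unfold quartPhi
  simp only [map_div₀, map_neg, map_add, map_pow, map_ofNat, quartConj_beta]
  ring

theorem quartTau_Phi : quartTau quartPhi = 1 - quartPhi := by
  have h : quartTau quartPhi = -((2 * quartI * (1 - quartPhi)) ^ 2 + 4) / 4 := by
    conv_lhs => unfold quartPhi
    simp only [map_div₀, map_neg, map_add, map_pow, map_ofNat, quartTau_beta]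
  rw [h]
  linear_combination (-(1 - quartPhi) ^ 2) * quartI_sq + quartPhi_sq

theorem quartTau_I : quartTau quartI = quartI := by
  have h := congrArg quartTau quartBeta_eq_I_mul_Phi
  rw [quartTau_beta, map_mul, map_mul, quartTau_Phi, map_ofNat] at h
  have h0 : (1 - quartPhi) ≠ 0 := by
    intro h0
    have := quartPhi_sq
    rw [← eq_of_sub_eq_zero h0] at this
    norm_num at this
  have h1 := mul_right_cancel₀ h0 h
  linear_combination -h1 / 2

theorem quartK_exists_rat (x : QuartK) : ∃ a b c d : ℚ,
    x = (a + b * quartI) + (c + d * quartI) * quartPhi := by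
  obtain ⟨p, rfl⟩ := AdjoinRoot.mk_surjective x
  have key : ∀ p : ℚ[X], ∃ a b c d : ℚ, Polynomial.aeval quartBeta p =
      ((a : QuartK) + b * quartI) + (c + d * quartI) * quartPhi := by
    intro p
    induction p using Polynomial.induction_on with
    | C a => exact ⟨a, 0, 0, 0, by simp⟩
    | add p q hp hq =>
      obtain ⟨a, b, c, d, h⟩ := hp
      obtain ⟨a', b', c', d', h'⟩ := hq
      exact ⟨a + a', b + b', c + c', d + d', by rw [map_add, h, h']; push_cast; ring⟩
    | monomial n a h =>
      obtain ⟨a, b, c, d, h⟩ := h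
      refine ⟨-2 * d, 2 * c, -2 * b - 2 * d, 2 * a + 2 * c, ?_⟩
      rw [pow_succ, ← mul_assoc, map_mul, h, aeval_X, quartBeta_eq_I_mul_Phi]
      push_cast
      linear_combination (2 * b * quartPhi + 2 * d * quartPhi ^ 2 : QuartK) * quartI_sq +
        (2 * c * quartI - 2 * d : QuartK) * quartPhi_sq
  obtain ⟨a, b, c, d, h⟩ := key p
  refine ⟨a, b, c, d, ?_⟩
  rw [← h]
  exact (AdjoinRoot.aeval_eq p).symm


theorem quartTau_apply (a b c d : ℚ) :
    quartTau (((a : QuartK) + b * quartI) + (c + d * quartI) * quartPhi) =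
      (a + b * quartI) + (c + d * quartI) * (1 - quartPhi) := by
  simp only [map_add, map_mul, map_ratCast, quartTau_I, quartTau_Phi]


theorem two_mul_quartPhi_sub_one_sq : (2 * quartPhi - 1) ^ 2 = 5 := by
  linear_combination 4 * quartPhi_sq

theorem two_mul_quartPhi_sub_one_ne_zero : 2 * quartPhi - 1 ≠ 0 := by
  intro h
  have := two_mul_quartPhi_sub_one_sq
  rw [h] at this
  norm_num at this

theorem quartK_rat_eq_zero {a b c d : ℚ}
    (h : ((a : QuartK) + b * quartI) + (c + d * quartI) * quartPhi = 0) :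
    a = 0 ∧ b = 0 ∧ c = 0 ∧ d = 0 := by
  have h1 := congrArg quartTau h
  rw [quartTau_apply, map_zero] at h1
  have hcd : (c : QuartK) + d * quartI = 0 := by
    apply (mul_eq_zero.mp _).resolve_right two_mul_quartPhi_sub_one_ne_zero
    linear_combination h - h1
  have hab : (a : QuartK) + b * quartI = 0 := by linear_combination h - quartPhi * hcd
  have key : ∀ s t : ℚ, (s : QuartK) + t * quartI = 0 → s = 0 ∧ t = 0 := by
    intro s t hst
    have h2 : ((s ^ 2 + t ^ 2 : ℚ) : QuartK) = ((0 : ℚ) : QuartK) := by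
      push_cast
      linear_combination (s - t * quartI : QuartK) * hst + (t ^ 2 : QuartK) * quartI_sq
    have h3 : s ^ 2 + t ^ 2 = 0 := Rat.cast_injective h2
    constructor <;> nlinarith [sq_nonneg s, sq_nonneg t]
  exact ⟨(key a b hab).1, (key a b hab).2, (key c d hcd).1, (key c d hcd).2⟩

theorem quartI_isIntegral : IsIntegral ℤ quartI :=
  ⟨X ^ 2 + C 1, by monicity!, by simp [quartI_sq]⟩

theorem quartPhi_isIntegral : IsIntegral ℤ quartPhi :=
  ⟨X ^ 2 - X - C 1, by monicity!, by simp [quartPhi_sq]⟩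

theorem exists_int_of_five_mul_sq_add_sq {s t : ℚ} {k l n : ℤ} (hs : 2 * s = k) (ht : 2 * t = l)
    (hn : 5 * (s ^ 2 + t ^ 2) = n) : (∃ m : ℤ, s = m) ∧ ∃ m : ℤ, t = m := by
  have h : 5 * (k ^ 2 + l ^ 2) = 4 * n := by
    have : (5 * (k ^ 2 + l ^ 2) : ℚ) = 4 * n := by rw [← hs, ← ht, ← hn]; ring
    exact_mod_cast this
  have h4 : (k ^ 2 + l ^ 2) % 4 = 0 := by omega
  have h2 : 2 ∣ k ∧ 2 ∣ l := by
    obtain ⟨k', hk⟩ : ∃ k', k = 2 * k' + k % 2 := ⟨k / 2, by omega⟩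
    obtain ⟨l', hl⟩ : ∃ l', l = 2 * l' + l % 2 := ⟨l / 2, by omega⟩
    rcases Int.emod_two_eq_zero_or_one k with h | h <;>
    rcases Int.emod_two_eq_zero_or_one l with h' | h'
    · exact ⟨by omega, by omega⟩
    all_goals
      exfalso
      rw [h] at hk
      rw [h'] at hl
      rw [hk, hl] at h4
      ring_nf at h4
      omega
  obtain ⟨⟨m, rfl⟩, ⟨m', rfl⟩⟩ := h2
  push_cast at hs ht
  exact ⟨⟨m, by linarith⟩, ⟨m', by linarith⟩⟩

theorem exists_int_of_sq_eq_int {q : ℚ} {n : ℤ} (h : q ^ 2 = n) : ∃ m : ℤ, q = m := by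
  apply exists_int_of_isIntegral_ratCast (F := ℚ)
  refine ⟨X ^ 2 - C n, by monicity!, ?_⟩
  rw [eval₂_sub, eval₂_X_pow, eval₂_C, Rat.cast_id, h]
  simp

theorem exists_int_of_five_mul_sq {q : ℚ} {n : ℤ} (h : 5 * q ^ 2 = n) : ∃ m : ℤ, q = m := by
  obtain ⟨m, hm⟩ := exists_int_of_sq_eq_int (q := 5 * q) (n := 5 * n) (by push_cast; rw [← h]; ring)
  have h1 : m ^ 2 = 5 * n := by
    have : (m ^ 2 : ℚ) = 5 * n := by rw [← hm, ← h]; ring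
    exact_mod_cast this
  obtain ⟨k, rfl⟩ : (5 : ℤ) ∣ m := Int.Prime.dvd_pow' (by norm_num) (h1 ▸ Dvd.intro _ rfl)
  exact ⟨k, by push_cast at hm; linarith⟩

theorem quartK_exists_int {x : QuartK} (hx : IsIntegral ℤ x) : ∃ a b c d : ℤ,
    x = (a + b * quartI) + (c + d * quartI) * quartPhi := by
  obtain ⟨a, b, c, d, rfl⟩ := quartK_exists_rat x
  set x : QuartK := ((a : QuartK) + b * quartI) + (c + d * quartI) * quartPhi with hxdef
  have hτ : IsIntegral ℤ (quartTau x) := map_isIntegral_int quartTau hx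
  have hy : IsIntegral ℤ (5 * ((c : QuartK) + d * quartI) ^ 2) := by
    have h := (hx.sub hτ).pow 2
    rw [hxdef, quartTau_apply] at h
    have e : (5 * ((c : QuartK) + d * quartI) ^ 2) =
        (((a : QuartK) + b * quartI) + (c + d * quartI) * quartPhi -
          ((a + b * quartI) + (c + d * quartI) * (1 - quartPhi))) ^ 2 := by
      linear_combination (-((c : QuartK) + d * quartI) ^ 2) * two_mul_quartPhi_sub_one_sq
    rw [e]; exact h
  have hyc : IsIntegral ℤ (5 * ((c : QuartK) - d * quartI) ^ 2) := by
    have h := map_isIntegral_int quartConj hy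
    simp only [map_add, map_mul, map_pow, map_ratCast, map_ofNat, quartConj_I] at h
    have e : (5 * ((c : QuartK) - d * quartI) ^ 2) = 5 * ((c : QuartK) + d * -quartI) ^ 2 := by ring
    rw [e]; exact h
  have e1 : ((10 * (c ^ 2 - d ^ 2) : ℚ) : QuartK) =
      5 * ((c : QuartK) + d * quartI) ^ 2 + 5 * ((c : QuartK) - d * quartI) ^ 2 := by
    push_cast; linear_combination (-10 * d ^ 2 : QuartK) * quartI_sq
  have e2 : (((5 * (c ^ 2 + d ^ 2)) ^ 2 : ℚ) : QuartK) =
      5 * ((c : QuartK) + d * quartI) ^ 2 * (5 * ((c : QuartK) - d * quartI) ^ 2) := by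
    have : ((c : QuartK) + d * quartI) * (c - d * quartI) = c ^ 2 + d ^ 2 := by
      linear_combination (-d ^ 2 : QuartK) * quartI_sq
    push_cast
    rw [← this]; ring
  obtain ⟨n1, hn1⟩ := exists_int_of_isIntegral_ratCast (e1 ▸ hy.add hyc)
  obtain ⟨n2, hn2⟩ := exists_int_of_isIntegral_ratCast (e2 ▸ hy.mul hyc)
  obtain ⟨n3, hn3⟩ := exists_int_of_sq_eq_int hn2
  obtain ⟨c2, hc2⟩ := exists_int_of_five_mul_sq (q := 2 * c) (n := n1 + 2 * n3)
    (by push_cast; rw [← hn1, ← hn3]; ring)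
  obtain ⟨d2, hd2⟩ := exists_int_of_five_mul_sq (q := 2 * d) (n := 2 * n3 - n1)
    (by push_cast; rw [← hn1, ← hn3]; ring)
  obtain ⟨⟨c', hc'⟩, d', hd'⟩ := exists_int_of_five_mul_sq_add_sq hc2 hd2 hn3
  have hB : IsIntegral ℤ ((c : QuartK) + d * quartI) := by
    rw [hc', hd', Rat.cast_intCast, Rat.cast_intCast]
    exact (isIntegral_algebraMap (R := ℤ) (x := c')).add
      ((isIntegral_algebraMap (R := ℤ) (x := d')).mul quartI_isIntegral)
  have hA : IsIntegral ℤ ((a : QuartK) + b * quartI) := by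
    have h := hx.sub (hB.mul quartPhi_isIntegral)
    rwa [hxdef, add_sub_cancel_right] at h
  have hAc : IsIntegral ℤ ((a : QuartK) - b * quartI) := by
    have h := map_isIntegral_int quartConj hA
    simp only [map_add, map_mul, map_ratCast, quartConj_I, mul_neg] at h
    rwa [sub_eq_add_neg]
  have f1 : ((2 * a : ℚ) : QuartK) = (a + b * quartI) + (a - b * quartI) := by push_cast; ring
  have f2 : ((2 * b : ℚ) : QuartK) = -(((a + b * quartI) - (a - b * quartI)) * quartI) := by
    push_cast; linear_combination (2 * b : QuartK) * quartI_sq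
  have f3 : ((a ^ 2 + b ^ 2 : ℚ) : QuartK) = (a + b * quartI) * (a - b * quartI) := by
    push_cast; linear_combination (b ^ 2 : QuartK) * quartI_sq
  obtain ⟨a2, ha2⟩ := exists_int_of_isIntegral_ratCast (f1 ▸ hA.add hAc)
  obtain ⟨b2, hb2⟩ :=
    exists_int_of_isIntegral_ratCast (f2 ▸ ((hA.sub hAc).mul quartI_isIntegral).neg)
  obtain ⟨n4, hn4⟩ := exists_int_of_isIntegral_ratCast (f3 ▸ hA.mul hAc)
  obtain ⟨⟨a', ha'⟩, b', hb'⟩ := exists_int_of_five_mul_sq_add_sq (n := 5 * n4) ha2 hb2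
    (by push_cast; rw [hn4])
  refine ⟨a', b', c', d', ?_⟩
  rw [hxdef, ha', hb', hc', hd']
  simp only [Rat.cast_intCast]

instance quartK_isTotallyComplex : NumberField.IsTotallyComplex QuartK :=
  isTotallyComplex_of_sq_eq_neg (x := quartI) (n := 1) (by norm_num)
    (by rw [quartI_sq]; norm_num)

/-- `i` as an algebraic integer. -/
noncomputable def intI : 𝓞 QuartK := ⟨quartI, quartI_isIntegral⟩

/-- The golden ratio as an algebraic integer. -/
noncomputable def intPhi : 𝓞 QuartK := ⟨quartPhi, quartPhi_isIntegral⟩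

@[simp]
theorem coe_intI : algebraMap (𝓞 QuartK) QuartK intI = quartI := rfl

@[simp]
theorem coe_intPhi : algebraMap (𝓞 QuartK) QuartK intPhi = quartPhi := rfl

theorem intI_sq : intI ^ 2 = -1 := by
  apply FaithfulSMul.algebraMap_injective (𝓞 QuartK) QuartK
  rw [map_pow, map_neg, map_one, coe_intI, quartI_sq]

theorem intPhi_sq : intPhi ^ 2 = intPhi + 1 := by
  apply FaithfulSMul.algebraMap_injective (𝓞 QuartK) QuartK
  rw [map_pow, map_add, map_one, coe_intPhi, quartPhi_sq]

theorem quartK_integer_eq (x : 𝓞 QuartK) : ∃ a b c d : ℤ,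
    x = (a + b * intI) + (c + d * intI) * intPhi := by
  obtain ⟨a, b, c, d, h⟩ := quartK_exists_int x.isIntegral_coe
  refine ⟨a, b, c, d, FaithfulSMul.algebraMap_injective (𝓞 QuartK) QuartK ?_⟩
  simp only [map_add, map_mul, map_intCast, coe_intI, coe_intPhi]
  exact h

theorem quartK_integer_eq_zero {a b c d : ℤ}
    (h : ((a : 𝓞 QuartK) + b * intI) + (c + d * intI) * intPhi = 0) :
    a = 0 ∧ b = 0 ∧ c = 0 ∧ d = 0 := by
  have h1 := congrArg (algebraMap (𝓞 QuartK) QuartK) h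
  simp only [map_add, map_mul, map_intCast, coe_intI, coe_intPhi, map_zero] at h1
  have := quartK_rat_eq_zero (a := a) (b := b) (c := c) (d := d) (by push_cast; exact h1)
  exact_mod_cast this

/-! `K₁ / K` is abelian and unramified -/

theorem embPos_alpha : embPos quadAlpha = quartAlpha :=
  AdjoinRoot.lift_root (f := (X ^ 2 + 5 : ℚ[X])) (i := algebraMap ℚ QuartK) _

theorem embNeg_alpha : embNeg quadAlpha = -quartAlpha :=
  AdjoinRoot.lift_root (f := (X ^ 2 + 5 : ℚ[X])) (i := algebraMap ℚ QuartK) _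

theorem algebraMap_quadAlpha : algebraMap QuadK QuartK quadAlpha = quartAlpha := embPos_alpha

theorem finrank_quadK_quartK : Module.finrank QuadK QuartK = 2 := by
  have h := Module.finrank_mul_finrank ℚ QuadK QuartK
  rw [quadK_finrank, quartK_finrank] at h
  omega

instance isQuadraticExtension_quadK_quartK : Algebra.IsQuadraticExtension QuadK QuartK where
  finrank_eq_two' := finrank_quadK_quartK

instance isAbelianGalois_quadK_quartK : IsAbelianGalois QuadK QuartK where

theorem aeval_derivative_mem_differentIdeal_of_monic (K L : Type*) [Field K] [NumberField K]
    [Field L] [NumberField L] [Algebra K L] (x : 𝓞 L)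
    (hx : Algebra.adjoin K {algebraMap (𝓞 L) L x} = ⊤) {f : (𝓞 K)[X]}
    (hfx : aeval x f = 0) : aeval x (derivative f) ∈ differentIdeal (𝓞 K) (𝓞 L) := by
  obtain ⟨g, rfl⟩ := minpoly.isIntegrallyClosed_dvd (R := 𝓞 K) (Algebra.IsIntegral.isIntegral x) hfx
  rw [derivative_mul, map_add, map_mul, map_mul, minpoly.aeval, zero_mul, add_zero]
  exact Ideal.mul_mem_right _ _ (aeval_derivative_mem_differentIdeal (𝓞 K) K L x hx)

theorem quartK_subalgebra_eq_top (S : Subalgebra QuadK QuartK) (h1 : quartI ∈ S)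
    (h2 : quartPhi ∈ S) : S = ⊤ := by
  rw [eq_top_iff]
  rintro x -
  obtain ⟨a, b, c, d, rfl⟩ := quartK_exists_rat x
  have hq : ∀ q : ℚ, (q : QuartK) ∈ S := fun q => by
    have : (q : QuartK) = algebraMap QuadK QuartK q := by simp
    rw [this]
    exact S.algebraMap_mem _
  exact S.add_mem (S.add_mem (hq a) (S.mul_mem (hq b) h1))
    (S.mul_mem (S.add_mem (hq c) (S.mul_mem (hq d) h1)) h2)

theorem adjoin_quartI : Algebra.adjoin QuadK {quartI} = ⊤ := by
  have hI : quartI ∈ Algebra.adjoin QuadK {quartI} := Algebra.self_mem_adjoin_singleton _ _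
  refine quartK_subalgebra_eq_top _ hI ?_
  have h : quartPhi = algebraMap QuadK QuartK (1 / 2) -
      algebraMap QuadK QuartK (quadAlpha / 2) * quartI := by
    rw [map_div₀, map_div₀, algebraMap_quadAlpha, quartAlpha_eq, map_one, map_ofNat]
    linear_combination (2 * quartPhi - 1) / 2 * quartI_sq
  rw [h]
  exact Subalgebra.sub_mem _ (Subalgebra.algebraMap_mem _ _)
    (Subalgebra.mul_mem _ (Subalgebra.algebraMap_mem _ _) hI)

theorem adjoin_quartPhi : Algebra.adjoin QuadK {quartPhi} = ⊤ := by
  have hP : quartPhi ∈ Algebra.adjoin QuadK {quartPhi} := Algebra.self_mem_adjoin_singleton _ _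
  refine quartK_subalgebra_eq_top _ ?_ hP
  have h : quartI = algebraMap QuadK QuartK (quadAlpha * 2 / 5) * quartPhi -
      algebraMap QuadK QuartK (quadAlpha / 5) := by
    rw [map_div₀, map_div₀, map_mul, algebraMap_quadAlpha, quartAlpha_eq, map_ofNat, map_ofNat]
    linear_combination -quartI / 5 * two_mul_quartPhi_sub_one_sq
  rw [h]
  exact Subalgebra.sub_mem _ (Subalgebra.mul_mem _ (Subalgebra.algebraMap_mem _ _) hP)
    (Subalgebra.algebraMap_mem _ _)

theorem differentIdeal_quadK_quartK : differentIdeal (𝓞 QuadK) (𝓞 QuartK) = ⊤ := by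
  have h1 := aeval_derivative_mem_differentIdeal_of_monic QuadK QuartK intI adjoin_quartI
    (f := X ^ 2 + 1) (by simp [intI_sq])
  have h2 := aeval_derivative_mem_differentIdeal_of_monic QuadK QuartK intPhi adjoin_quartPhi
    (f := X ^ 2 - X - 1) (by simp [intPhi_sq])
  rw [Ideal.eq_top_iff_one]
  have h3 : (1 : 𝓞 QuartK) = aeval intPhi (derivative (X ^ 2 - X - 1 : (𝓞 QuadK)[X])) *
      aeval intPhi (derivative (X ^ 2 - X - 1 : (𝓞 QuadK)[X])) +
      2 * intI * aeval intI (derivative (X ^ 2 + 1 : (𝓞 QuadK)[X])) := by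
    simp
    linear_combination -4 * intI_sq - 4 * intPhi_sq
  rw [h3]
  exact Ideal.add_mem _ (Ideal.mul_mem_left _ _ h2) (Ideal.mul_mem_left _ _ h1)

instance formallyUnramified_quadK_quartK : Algebra.FormallyUnramified (𝓞 QuadK) (𝓞 QuartK) :=
  formallyUnramified_of_differentIdeal_eq_top _ _ differentIdeal_quadK_quartK

theorem isAbelianUnramified_quadK_quartK : IsAbelianUnramified QuadK QuartK where
  isAbelianGalois := inferInstance
  isUnramifiedAt P _ _ := isUnramifiedAt_of_formallyUnramified QuadK QuartK P
  isUnramifiedAtInfinitePlaces := ⟨fun _ =>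
    NumberField.InfinitePlace.isUnramified_iff.mpr
      (Or.inr (NumberField.IsTotallyComplex.isComplex _))⟩

/-! Class groups -/

theorem natAbs_discr_quadK_le : (NumberField.discr QuadK).natAbs ≤ 20 := by
  have hadj : Algebra.adjoin ℚ {quadAlpha} = ⊤ := by
    rw [eq_top_iff]
    rintro x -
    obtain ⟨s, t, rfl⟩ := quadK_exists_rat x
    have hq : ∀ q : ℚ, (q : QuadK) ∈ Algebra.adjoin ℚ {quadAlpha} := fun q =>
      Subalgebra.algebraMap_mem _ q
    exact Subalgebra.add_mem _ (hq s)
      (Subalgebra.mul_mem _ (hq t) (Algebra.self_mem_adjoin_singleton _ _))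
  have h1 : 2 * intAlpha ∈ differentIdeal ℤ (𝓞 QuadK) := by
    obtain ⟨g, hg⟩ := minpoly.isIntegrallyClosed_dvd (R := ℤ) (p := X ^ 2 + C 5)
      (Algebra.IsIntegral.isIntegral intAlpha)
      (by rw [map_add, map_pow, aeval_X, aeval_C, intAlpha_sq, map_ofNat]; norm_num)
    have h2 := aeval_derivative_mem_differentIdeal ℤ ℚ QuadK intAlpha hadj
    have h3 := congrArg (fun f => aeval intAlpha (derivative f)) hg
    simp only [derivative_mul, map_add, map_mul, minpoly.aeval, zero_mul, add_zero] at h3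
    have h4 : aeval intAlpha (derivative (X ^ 2 : ℤ[X])) = 2 * intAlpha := by
      rw [derivative_X_pow, map_mul, aeval_C, map_pow, aeval_X]
      simp
    have h5 : aeval intAlpha (derivative (C 5 : ℤ[X])) = 0 := by rw [derivative_C, map_zero]
    rw [h4, h5, add_zero] at h3
    rw [h3]
    exact Ideal.mul_mem_right _ _ h2
  have h2 : Ideal.absNorm (differentIdeal ℤ (𝓞 QuadK)) ∣
      Ideal.absNorm (Ideal.span {2 * intAlpha}) :=
    Ideal.absNorm_dvd_absNorm_of_le ((Ideal.span_singleton_le_iff_mem _).mpr h1)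
  rw [NumberField.absNorm_differentIdeal QuadK, Ideal.absNorm_span_singleton] at h2
  have hrank : Module.finrank ℤ (𝓞 QuadK) = 2 := by
    rw [NumberField.RingOfIntegers.rank, quadK_finrank]
  have h3 : (Algebra.norm ℤ (2 * intAlpha)).natAbs = 20 := by
    have h4 : (Algebra.norm ℤ (2 * intAlpha)) ^ 2 = 20 ^ 2 := by
      rw [← map_pow, mul_pow, intAlpha_sq,
        show (2 ^ 2 * -5 : 𝓞 QuadK) = algebraMap ℤ (𝓞 QuadK) (-20) by push_cast; norm_num,
        Algebra.norm_algebraMap, hrank]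
      norm_num
    rcases sq_eq_sq_iff_eq_or_eq_neg.mp h4 with h | h <;> rw [h] <;> rfl
  rw [h3] at h2
  exact Nat.le_of_dvd (by norm_num) h2

theorem natAbs_discr_quartK_le : (NumberField.discr QuartK).natAbs ≤ 400 := by
  rw [NumberField.natAbs_discr_eq_absNorm_differentIdeal_mul_natAbs_discr_pow QuadK (𝓞 QuadK)
    QuartK (𝓞 QuartK), differentIdeal_quadK_quartK, finrank_quadK_quartK, Ideal.absNorm_top, one_mul]
  exact (Nat.pow_le_pow_left natAbs_discr_quadK_le 2)

/-- In the residue field of an ideal of prime norm `q`, the Frobenius `x ↦ x ^ q` is trivial. -/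
theorem pow_sub_self_mem_of_absNorm_prime {F : Type*} [Field F] [NumberField F]
    {J : Ideal (𝓞 F)} {q : ℕ} (hq : q.Prime) (hJ : Ideal.absNorm J = q) (x : 𝓞 F) :
    x ^ q - x ∈ J := by
  have hJ0 : J ≠ ⊥ := fun h => hq.ne_zero (by rw [← hJ, h, Ideal.absNorm_bot])
  have hp : J.IsPrime := Ideal.isPrime_of_irreducible_absNorm (by rw [hJ]; exact hq)
  have hm : J.IsMaximal := hp.isMaximal hJ0
  let _ := Ideal.Quotient.field J
  have hcard : Nat.card (𝓞 F ⧸ J) = q := by rw [← hJ]; rfl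
  have hfin : Finite (𝓞 F ⧸ J) := Nat.finite_of_card_ne_zero (by rw [hcard]; exact hq.ne_zero)
  let _ := Fintype.ofFinite (𝓞 F ⧸ J)
  have h := FiniteField.pow_card (Ideal.Quotient.mk J x)
  rw [← Nat.card_eq_fintype_card, hcard, ← map_pow] at h
  exact Ideal.Quotient.eq.mp h

theorem sq_discr_le {F : Type*} [Field F] [NumberField F] {d : ℕ}
    (h : (NumberField.discr F).natAbs ≤ d ^ 2) :
    √|((NumberField.discr F : ℤ) : ℝ)| ≤ d := by
  rw [Real.sqrt_le_left (by positivity)]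
  have : ((NumberField.discr F).natAbs : ℝ) ≤ (d : ℝ) ^ 2 := by exact_mod_cast h
  rwa [Nat.cast_natAbs, Int.cast_abs] at this

/-- The prime of `ℤ[√-5]` above `2`. -/
noncomputable def primeTwo : Ideal (𝓞 QuadK) := Ideal.span {2, 1 + intAlpha}

theorem primeTwo_sq : primeTwo ^ 2 = Ideal.span {2} := by
  have h2 : (2 : 𝓞 QuadK) ∈ primeTwo := Ideal.subset_span (by simp)
  have hα : 1 + intAlpha ∈ primeTwo := Ideal.subset_span (by simp)
  apply le_antisymm
  · rw [pow_two, primeTwo, Ideal.span_mul_span', Ideal.span_le]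
    rintro _ ⟨x, hx, y, hy, rfl⟩
    simp only [SetLike.mem_coe, Ideal.mem_span_singleton]
    simp only [Set.mem_insert_iff, Set.mem_singleton_iff] at hx hy
    rcases hx with rfl | rfl <;> rcases hy with rfl | rfl
    · exact Dvd.intro _ rfl
    · exact Dvd.intro _ rfl
    · exact Dvd.intro_left _ rfl
    · exact ⟨intAlpha - 2, by linear_combination intAlpha_sq⟩
  · rw [Ideal.span_singleton_le_iff_mem, pow_two]
    have h : (2 : 𝓞 QuadK) = 2 * (1 + intAlpha) - (1 + intAlpha) * (1 + intAlpha) - 2 * 2 := by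
      linear_combination intAlpha_sq
    rw [h]
    exact sub_mem (sub_mem (Ideal.mul_mem_mul h2 hα) (Ideal.mul_mem_mul hα hα))
      (Ideal.mul_mem_mul h2 h2)

theorem eq_primeTwo_of_absNorm_eq_two {J : Ideal (𝓞 QuadK)} (hJ : Ideal.absNorm J = 2) :
    J = primeTwo := by
  have hp : J.IsPrime := Ideal.isPrime_of_irreducible_absNorm (by rw [hJ]; exact Nat.prime_two)
  have h2 : (2 : 𝓞 QuadK) ∈ J := by
    have := Ideal.absNorm_mem J
    rw [hJ] at this
    exact_mod_cast this
  have hα : 1 + intAlpha ∈ J := by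
    refine hp.mem_of_pow_mem 2 ?_
    have h : (1 + intAlpha) ^ 2 = (intAlpha - 2) * 2 := by linear_combination intAlpha_sq
    rw [h]
    exact J.mul_mem_left _ h2
  apply le_antisymm
  · intro x hx
    obtain ⟨m, n, rfl⟩ := quadK_integer_eq x
    have h2' : (2 : 𝓞 QuadK) ∈ primeTwo := Ideal.subset_span (by simp)
    have hα' : 1 + intAlpha ∈ primeTwo := Ideal.subset_span (by simp)
    have hmn : ((m - n : ℤ) : 𝓞 QuadK) ∈ J := by
      have : ((m - n : ℤ) : 𝓞 QuadK) = (m + n * intAlpha) - n * (1 + intAlpha) := by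
        push_cast; ring
      rw [this]
      exact sub_mem hx (J.mul_mem_left _ hα)
    obtain ⟨k, hk⟩ : (2 : ℤ) ∣ m - n := by
      by_contra hodd
      obtain ⟨k, hk⟩ : ∃ k, m - n = 2 * k + 1 := ⟨(m - n) / 2, by omega⟩
      apply hp.ne_top
      rw [Ideal.eq_top_iff_one]
      have : (1 : 𝓞 QuadK) = ((m - n : ℤ) : 𝓞 QuadK) - k * 2 := by rw [hk]; push_cast; ring
      rw [this]
      exact sub_mem hmn (J.mul_mem_left _ h2)
    have : (m + n * intAlpha : 𝓞 QuadK) = k * 2 + n * (1 + intAlpha) := by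
      have : (m : 𝓞 QuadK) - n = 2 * k := by exact_mod_cast congrArg (Int.cast : ℤ → 𝓞 QuadK) hk
      linear_combination this
    rw [this]
    exact add_mem (primeTwo.mul_mem_left _ h2') (primeTwo.mul_mem_left _ hα')
  · rw [primeTwo, Ideal.span_le]
    rintro x (rfl | rfl)
    · exact h2
    · exact hα

theorem nrComplexPlaces_quadK : NumberField.InfinitePlace.nrComplexPlaces QuadK = 1 := by
  have := NumberField.IsTotallyComplex.finrank (K := QuadK)
  rw [quadK_finrank] at this
  omega

theorem nrComplexPlaces_quartK : NumberField.InfinitePlace.nrComplexPlaces QuartK = 2 := by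
  have := NumberField.IsTotallyComplex.finrank (K := QuartK)
  rw [quartK_finrank] at this
  omega

open scoped nonZeroDivisors in
/-- The class group of `ℚ(√-5)` is generated by the class of the prime above `2`. -/
theorem quadK_exists_span_mul_eq (I : Ideal (𝓞 QuadK)) (hI : I ≠ ⊥) :
    ∃ a b : 𝓞 QuadK, a ≠ 0 ∧ b ≠ 0 ∧
      (Ideal.span {a} * I = Ideal.span {b} ∨ Ideal.span {a} * I = Ideal.span {b} * primeTwo) := by
  obtain ⟨J, hJ, hle⟩ := NumberField.exists_ideal_in_class_of_norm_le
    (ClassGroup.mk0 ⟨I, mem_nonZeroDivisors_of_ne_zero hI⟩)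
  obtain ⟨b, a, hb, ha, hab⟩ := ClassGroup.mk0_eq_mk0_iff.mp hJ
  have hlt : Ideal.absNorm (J : Ideal (𝓞 QuadK)) < 3 := by
    have h1 : √|((NumberField.discr QuadK : ℤ) : ℝ)| ≤ (4.5 : ℝ) := by
      rw [Real.sqrt_le_left (by norm_num)]
      have : ((NumberField.discr QuadK).natAbs : ℝ) ≤ 20 := by exact_mod_cast natAbs_discr_quadK_le
      rw [Nat.cast_natAbs, Int.cast_abs] at this
      linarith
    rw [nrComplexPlaces_quadK, quadK_finrank] at hle
    have h2 : (4 / Real.pi) ≤ 1.28 := by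
      rw [div_le_iff₀ Real.pi_pos]
      linarith [Real.pi_gt_d2]
    have h3 : (4 / Real.pi) ^ 1 * (((2).factorial : ℝ) / (2 : ℕ) ^ 2 *
        √|((NumberField.discr QuadK : ℤ) : ℝ)|) < 3 := by
      rw [pow_one]
      calc _ ≤ 1.28 * (((2).factorial : ℝ) / (2 : ℕ) ^ 2 * 4.5) := by gcongr
        _ < 3 := by norm_num [Nat.factorial]
    exact_mod_cast hle.trans_lt h3
  refine ⟨a, b, ha, hb, ?_⟩
  have hpos : Ideal.absNorm (J : Ideal (𝓞 QuadK)) ≠ 0 :=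
    Ideal.absNorm_eq_zero_iff.not.mpr (nonZeroDivisors.coe_ne_zero J)
  obtain h | h : Ideal.absNorm (J : Ideal (𝓞 QuadK)) = 1 ∨
    Ideal.absNorm (J : Ideal (𝓞 QuadK)) = 2 := by omega
  · left
    rw [Ideal.absNorm_eq_one_iff] at h
    rw [← hab, h, Ideal.mul_top]
  · right
    rw [← hab, eq_primeTwo_of_absNorm_eq_two h]

theorem isPrincipal_of_span_mul_eq {R : Type*} [CommRing R] [IsDedekindDomain R]
    {I : Ideal R} {a b : R} (ha : a ≠ 0) (h : Ideal.span {a} * I = Ideal.span {b}) :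
    I.IsPrincipal := by
  have hb : b ∈ Ideal.span {a} * I := h ▸ Ideal.mem_span_singleton_self b
  obtain ⟨c, -, rfl⟩ := Ideal.mem_span_singleton_mul.mp hb
  refine ⟨c, ?_⟩
  rw [← Ideal.span_singleton_mul_span_singleton] at h
  exact mul_left_cancel₀ (by rwa [Ne, Ideal.zero_eq_bot, Ideal.span_singleton_eq_bot]) h

theorem quadK_sq_isPrincipal (I : Ideal (𝓞 QuadK)) (hI : I ≠ ⊥) : (I ^ 2).IsPrincipal := by
  obtain ⟨a, b, ha, -, h | h⟩ := quadK_exists_span_mul_eq I hI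
  · apply isPrincipal_of_span_mul_eq (pow_ne_zero 2 ha) (b := b ^ 2)
    rw [← Ideal.span_singleton_pow, ← Ideal.span_singleton_pow, ← mul_pow, h]
  · apply isPrincipal_of_span_mul_eq (pow_ne_zero 2 ha) (b := b ^ 2 * 2)
    rw [← Ideal.span_singleton_pow, ← mul_pow, h, mul_pow, primeTwo_sq, Ideal.span_singleton_pow,
      Ideal.span_singleton_mul_span_singleton]

instance quartK_isPrincipalIdealRing : IsPrincipalIdealRing (𝓞 QuartK) := by
  apply RingOfIntegers.isPrincipalIdealRing_of_isPrincipal_of_norm_le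
  intro J hle
  have hlt : Ideal.absNorm (J : Ideal (𝓞 QuartK)) < 4 := by
    have h1 : √|((NumberField.discr QuartK : ℤ) : ℝ)| ≤ ((20 : ℕ) : ℝ) :=
      sq_discr_le natAbs_discr_quartK_le
    rw [nrComplexPlaces_quartK, quartK_finrank] at hle
    have h2 : (4 / Real.pi) ≤ 1.28 := by
      rw [div_le_iff₀ Real.pi_pos]
      linarith [Real.pi_gt_d2]
    have h3 : (4 / Real.pi) ^ 2 * (((4).factorial : ℝ) / (4 : ℕ) ^ 4 *
        √|((NumberField.discr QuartK : ℤ) : ℝ)|) < 4 := by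
      calc _ ≤ 1.28 ^ 2 * (((4).factorial : ℝ) / (4 : ℕ) ^ 4 * (20 : ℕ)) := by gcongr
        _ < 4 := by norm_num [Nat.factorial]
    exact_mod_cast hle.trans_lt h3
  have hpos : Ideal.absNorm (J : Ideal (𝓞 QuartK)) ≠ 0 :=
    Ideal.absNorm_eq_zero_iff.not.mpr (nonZeroDivisors.coe_ne_zero J)
  obtain h | h | h : Ideal.absNorm (J : Ideal (𝓞 QuartK)) = 1 ∨
    Ideal.absNorm (J : Ideal (𝓞 QuartK)) = 2 ∨ Ideal.absNorm (J : Ideal (𝓞 QuartK)) = 3 := by omega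
  · rw [Ideal.absNorm_eq_one_iff] at h
    rw [h]
    exact top_isPrincipal
  · have h1 := pow_sub_self_mem_of_absNorm_prime Nat.prime_two h intPhi
    rw [intPhi_sq, add_sub_cancel_left] at h1
    rw [(Ideal.eq_top_iff_one _).mpr h1]
    exact top_isPrincipal
  · have h1 := pow_sub_self_mem_of_absNorm_prime Nat.prime_three h intI
    have h3 := Ideal.absNorm_mem (J : Ideal (𝓞 QuartK))
    rw [h] at h3
    have h4 : (1 : 𝓞 QuartK) = ((3 : ℕ) : 𝓞 QuartK) - intI * (intI ^ 3 - intI) := by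
      push_cast
      linear_combination (intI ^ 2 - 2) * intI_sq
    have h5 : (1 : 𝓞 QuartK) ∈ (J : Ideal (𝓞 QuartK)) := by
      rw [h4]
      exact sub_mem h3 (Ideal.mul_mem_left _ _ h1)
    rw [(Ideal.eq_top_iff_one _).mpr h5]
    exact top_isPrincipal

/-! Unramified extensions of prime degree of `ℚ(√-5)` and of `K₁` -/

section Generator

variable {K L : Type} [Field K] [NumberField K] [Field L] [NumberField L] [Algebra K L]

theorem exists_algebraMap_eq_of_fixed [IsGalois K L] {g : Gal(L/K)}
    (hg : ∀ x, x ∈ Subgroup.zpowers g) {x : L} (hx : g x = x) : ∃ k : K, algebraMap K L k = x := by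
  refine (IsGalois.mem_range_algebraMap_iff_fixed x).mpr fun τ => ?_
  obtain ⟨n, rfl⟩ := mem_powers_iff_mem_zpowers.mpr (hg τ)
  simp only
  induction n with
  | zero => rfl
  | succ n ih => rw [pow_succ, AlgEquiv.mul_apply, hx, ih]

theorem univ_eq_of_finrank_eq_two [IsGalois K L] (h2 : Module.finrank K L = 2) {g : Gal(L/K)}
    (hg : ∀ x, x ∈ Subgroup.zpowers g) [DecidableEq Gal(L/K)] :
    g ≠ 1 ∧ (Finset.univ : Finset Gal(L/K)) = {1, g} := by
  have hcard : Fintype.card Gal(L/K) = 2 := by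
    rw [← Nat.card_eq_fintype_card, IsGalois.card_aut_eq_finrank, h2]
  have hg1 : g ≠ 1 := by
    rintro rfl
    have : Fintype.card Gal(L/K) ≤ 1 := by
      rw [Fintype.card_le_one_iff]
      intro a b
      have ha := hg a
      have hb := hg b
      rw [Subgroup.zpowers_one_eq_bot, Subgroup.mem_bot] at ha hb
      rw [ha, hb]
    omega
  refine ⟨hg1, (Finset.eq_of_subset_of_card_le (Finset.subset_univ _) ?_).symm⟩
  rw [Finset.card_univ, hcard, Finset.card_pair hg1.symm]

theorem algebraMap_norm_of_finrank_eq_two [IsGalois K L] (h2 : Module.finrank K L = 2)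
    {g : Gal(L/K)} (hg : ∀ x, x ∈ Subgroup.zpowers g) (x : L) :
    algebraMap K L (Algebra.norm K x) = x * g x := by
  classical
  obtain ⟨hg1, hu⟩ := univ_eq_of_finrank_eq_two h2 hg
  rw [Algebra.norm_eq_prod_automorphisms, hu, Finset.prod_pair hg1.symm]
  rfl

theorem algebraMap_trace_of_finrank_eq_two [IsGalois K L] (h2 : Module.finrank K L = 2)
    {g : Gal(L/K)} (hg : ∀ x, x ∈ Subgroup.zpowers g) (x : L) :
    algebraMap K L (Algebra.trace K L x) = x + g x := by
  classical
  obtain ⟨hg1, hu⟩ := univ_eq_of_finrank_eq_two h2 hg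
  rw [trace_eq_sum_automorphisms, hu, Finset.sum_pair hg1.symm]
  rfl

theorem exists_generator_of_finrank_prime [IsGalois K L] {p : ℕ} (hp : p.Prime)
    (h : Module.finrank K L = p) :
    IsCyclic Gal(L/K) ∧ ∃ g : Gal(L/K), (∀ x, x ∈ Subgroup.zpowers g) ∧ g ^ p = 1 := by
  have : Fact p.Prime := ⟨hp⟩
  have hcard : Nat.card Gal(L/K) = p := by rw [IsGalois.card_aut_eq_finrank, h]
  have hc : IsCyclic Gal(L/K) := isCyclic_of_prime_card hcard
  obtain ⟨g, hg⟩ := hc.exists_generator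
  exact ⟨hc, g, hg, by rw [← hcard]; exact pow_card_eq_one'⟩

theorem unitsNorm_neg_one : unitsNorm K L (-1) = (-1) ^ Module.finrank K L := by
  ext
  rw [coe_unitsNorm]
  have : (((-1 : (𝓞 L)ˣ) : 𝓞 L) : L) = algebraMap K L (-1) := by simp
  rw [this, Algebra.norm_algebraMap]
  simp

end Generator

theorem finrank_ne_odd_prime_of_unramified {L : Type} [Field L] [NumberField L] [Algebra QuadK L]
    [IsGalois QuadK L] [Algebra.FormallyUnramified (𝓞 QuadK) (𝓞 L)] {p : ℕ} (hp : p.Prime)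
    (hp2 : p ≠ 2) : Module.finrank QuadK L ≠ p := by
  intro h
  obtain ⟨_, g, hg, hgp⟩ := exists_generator_of_finrank_prime hp h
  have hN1 : unitsNorm QuadK L (-1) = -1 := by
    rw [unitsNorm_neg_one, h, (hp.odd_of_ne_two hp2).neg_one_pow]
  have hdiv := exists_pow_eq_of_cohomology hp hp2 (unitsAut QuadK L g)
    (by
      ext x
      rw [coe_unitsAut_pow, hgp]
      rfl)
    (unitsNorm QuadK L) (-1) (by simp)
    (by
      ext
      rw [coe_unitsAut]
      simp)
    (fun x => by rw [hN1]; exact quadK_unit_eq _)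
    (fun η hη => exists_unitsAut_of_unitsNorm_eq_one QuadK L hg quadK_sq_isPrincipal η hη)
  have : NumberField.IsTotallyComplex L := NumberField.isTotallyComplex_of_algebra QuadK L
  have hfin : Module.finrank ℚ L = 2 * p := by
    rw [← Module.finrank_mul_finrank ℚ QuadK L, quadK_finrank, h]
  have hr := rank_add_one_of_isTotallyComplex L hfin
  obtain ⟨x, hx⟩ := exists_unit_not_pow L (by have := hp.two_le; omega) hp
  obtain ⟨y, hy⟩ := hdiv x
  exact hx y hy

theorem finrank_ne_two_of_unramified_quartK {M : Type} [Field M] [NumberField M]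
    [Algebra QuartK M] [Algebra.FormallyUnramified (𝓞 QuartK) (𝓞 M)] :
    Module.finrank QuartK M ≠ 2 := by
  intro h
  have : Algebra.IsQuadraticExtension QuartK M := ⟨h⟩
  obtain ⟨_, g, hg, hgp⟩ := exists_generator_of_finrank_prime Nat.prime_two h
  have : NumberField.IsTotallyComplex M := NumberField.isTotallyComplex_of_algebra QuartK M
  have hfin : Module.finrank ℚ M = 2 * 4 := by
    rw [← Module.finrank_mul_finrank ℚ QuartK M, quartK_finrank, h]
  have hr := rank_add_one_of_isTotallyComplex M hfin
  have hr₀ := rank_add_one_of_isTotallyComplex QuartK (n := 2) quartK_finrank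
  have hι : ∀ y : (𝓞 QuartK)ˣ,
      ((Units.map (algebraMap (𝓞 QuartK) (𝓞 M)).toMonoidHom y : 𝓞 M) : M) =
        algebraMap QuartK M (y : 𝓞 QuartK) := fun y => rfl
  have key := two_mul_index_squares_le
    (Units.map (algebraMap (𝓞 QuartK) (𝓞 M)).toMonoidHom) (unitsNorm QuartK M)
    (unitsAut QuartK M g)
    (fun x => by
      ext
      rw [hι, coe_unitsNorm, algebraMap_norm_of_finrank_eq_two h hg]
      rfl)
    (fun y => by
      ext
      rw [coe_unitsAut, hι, AlgEquiv.commutes])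
    (-1)
    (by
      have h1 : Units.map (algebraMap (𝓞 QuartK) (𝓞 M)).toMonoidHom (-1) = -1 := by
        ext
        simp
      rw [h1, unitsNorm_neg_one, h]
      norm_num)
    (fun h1 => by
      have h2 := congrArg (fun u : (𝓞 M)ˣ => ((u : 𝓞 M) : M)) h1
      simp only [hι] at h2
      norm_num at h2)
    (fun x hx => by
      have h1 : (x : 𝓞 M) ^ 2 = 1 := by
        rw [← Units.val_pow_eq_pow_val, hx, Units.val_one]
      rcases sq_eq_one_iff.mp h1 with h2 | h2
      · left; exact Units.ext h2
      · right; ext; rw [hι, h2]; simp)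
    (fun x y hxy => by
      ext
      have h2 := congrArg (fun u : (𝓞 M)ˣ => ((u : 𝓞 M) : M)) hxy
      simp only [hι] at h2
      exact (algebraMap QuartK M).injective h2)
    (fun η hη => by
      obtain ⟨ε, hε⟩ := exists_unitsAut_of_unitsNorm_eq_one QuartK M hg (k := 1)
        (fun I _ => IsPrincipalIdealRing.principal _) η hη
      rw [pow_one] at hε
      exact ⟨ε, hε⟩)
    (by rw [index_range_pow_two_units]; positivity)
  rw [index_range_pow_two_units, index_range_pow_two_units, hr, hr₀] at key
  norm_num at key

theorem exists_sq_eq_neg_one_of_unramified {L : Type} [Field L] [NumberField L] [Algebra QuadK L]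
    [Algebra.FormallyUnramified (𝓞 QuadK) (𝓞 L)] (h : Module.finrank QuadK L = 2) :
    ∃ θ : L, θ ^ 2 = -1 := by
  have : Algebra.IsQuadraticExtension QuadK L := ⟨h⟩
  obtain ⟨_, g, hg, hgp⟩ := exists_generator_of_finrank_prime Nat.prime_two h
  have hneg : unitsNorm QuadK L (-1) = 1 := by
    rw [unitsNorm_neg_one, h]
    norm_num
  obtain ⟨x, I, hx0, hgx, hI⟩ := exists_span_eq_map_of_unitsNorm_eq_one QuadK L hg (-1) hneg
  have hgx' : g • x = -x := by
    rw [Units.val_neg, Units.val_one, neg_one_mul] at hgx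
    exact neg_eq_iff_eq_neg.mp hgx
  have hgxL : g (x : L) = -(x : L) := by
    have := congrArg (algebraMap (𝓞 L) L) hgx'
    rw [map_neg] at this
    exact this
  have hIb : I ≠ ⊥ := by
    rintro rfl
    rw [Ideal.map_bot, Ideal.span_singleton_eq_bot] at hI
    exact hx0 hI
  have hxL : (x : L) ≠ 0 := by simpa using hx0
  obtain ⟨a, b, ha, hb, hab⟩ := quadK_exists_span_mul_eq I hIb
  set φ := algebraMap (𝓞 QuadK) (𝓞 L) with hφ
  have hφ0 : ∀ c, c ≠ 0 → φ c ≠ 0 := fun c hc => by simpa [hφ] using hc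
  have hφL : ∀ c, ((φ c : 𝓞 L) : L) = algebraMap QuadK L c := fun c => rfl
  have hφg : ∀ c, g ((φ c : 𝓞 L) : L) = (φ c : 𝓞 L) := fun c => by rw [hφL, AlgEquiv.commutes]
  have hφL0 : ∀ c, c ≠ 0 → ((φ c : 𝓞 L) : L) ≠ 0 := fun c hc => by simpa using hφ0 c hc
  have hnorm : ∀ u : (𝓞 L)ˣ, ((u : 𝓞 L) : L) * g (u : 𝓞 L) = 1 ∨
      ((u : 𝓞 L) : L) * g (u : 𝓞 L) = -1 := by
    intro u
    rw [← algebraMap_norm_of_finrank_eq_two h hg, ← coe_unitsNorm]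
    rcases quadK_unit_eq (unitsNorm QuadK L u) with h1 | h1 <;> rw [h1]
    · left; simp
    · right; simp
  rcases hab with hab | hab
  · have h1 : Ideal.span {φ b} = Ideal.span {φ a * x} := by
      rw [← Ideal.span_singleton_mul_span_singleton, hI, ← Set.image_singleton (f := φ) (a := a),
        ← Ideal.map_span, ← Ideal.map_mul, hab, Ideal.map_span, Set.image_singleton]
    obtain ⟨u, hu⟩ := Ideal.span_singleton_eq_span_singleton.mp h1
    have huL : ((φ b : 𝓞 L) : L) * (u : 𝓞 L) = (φ a : 𝓞 L) * (x : L) := by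
      rw [← map_mul, hu, map_mul]
    have hgu : g ((u : 𝓞 L) : L) = -((u : 𝓞 L) : L) := by
      apply mul_left_cancel₀ (hφL0 b hb)
      have h2 := congrArg g huL
      rw [map_mul, map_mul, hφg, hφg, hgxL] at h2
      rw [h2]
      linear_combination huL
    have hu0 : ((u : 𝓞 L) : L) ≠ 0 := by simp
    rcases hnorm u with h2 | h2
    · exact ⟨(u : 𝓞 L), by rw [hgu] at h2; linear_combination -h2⟩
    · exfalso
      rw [hgu] at h2
      have h3 : ((u : 𝓞 L) : L) ^ 2 = 1 := by linear_combination -h2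
      rcases sq_eq_one_iff.mp h3 with h4 | h4 <;> rw [h4] at hgu <;> simp at hgu <;>
        norm_num [self_eq_neg] at hgu
  · have h1 : Ideal.span {φ (b ^ 2 * 2)} = Ideal.span {(φ a * x) ^ 2} := by
      rw [← Ideal.span_singleton_pow, ← Ideal.span_singleton_mul_span_singleton, hI,
        ← Set.image_singleton (f := φ) (a := a), ← Ideal.map_span, ← Ideal.map_mul, hab,
        ← Ideal.map_pow, mul_pow, primeTwo_sq, Ideal.span_singleton_pow,
        Ideal.span_singleton_mul_span_singleton, Ideal.map_span, Set.image_singleton]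
    obtain ⟨u, hu⟩ := Ideal.span_singleton_eq_span_singleton.mp h1
    have huL : ((φ (b ^ 2 * 2) : 𝓞 L) : L) * (u : 𝓞 L) = ((φ a : 𝓞 L) * (x : L)) ^ 2 := by
      rw [← map_mul, hu, map_pow, map_mul]
    have hb2 : b ^ 2 * 2 ≠ 0 := mul_ne_zero (pow_ne_zero 2 hb) two_ne_zero
    have hgu : g ((u : 𝓞 L) : L) = ((u : 𝓞 L) : L) := by
      apply mul_left_cancel₀ (hφL0 _ hb2)
      have h2 := congrArg g huL
      rw [map_mul g, map_pow g, map_mul g, hφg, hφg, hgxL] at h2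
      rw [h2]
      linear_combination -huL
    have hu2 := hnorm u
    rw [hgu, ← pow_two] at hu2
    rcases hu2 with hu2 | hu2
    swap
    · exact ⟨_, hu2⟩
    exfalso
    obtain ⟨s, hs, hus⟩ : ∃ s : ℤ, (s = 1 ∨ s = -1) ∧ ((u : 𝓞 L) : L) = s := by
      rcases sq_eq_one_iff.mp hu2 with h3 | h3
      · exact ⟨1, Or.inl rfl, by rw [h3]; simp⟩
      · exact ⟨-1, Or.inr rfl, by rw [h3]; simp⟩
    obtain ⟨y, hy⟩ := exists_trace_eq_one QuadK L
    have hyL : (y : L) + g y = 1 := by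
      rw [← algebraMap_trace_of_finrank_eq_two h hg, ← Algebra.algebraMap_intTrace (A := 𝓞 QuadK),
        hy, map_one, map_one]
    set n : 𝓞 QuadK := RingOfIntegers.norm QuadK y with hn
    have hyN : algebraMap QuadK L n = (y : L) * (1 - y) := by
      rw [hn, RingOfIntegers.coe_norm, algebraMap_norm_of_finrank_eq_two h hg]
      linear_combination (y : L) * hyL
    set δ : L := (φ a : 𝓞 L) * (x : L) / (φ b : 𝓞 L) with hδ
    have hδg : g δ = -δ := by
      rw [hδ, map_div₀, map_mul, hφg, hφg, hgxL]
      ring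
    have hδ2 : δ ^ 2 = 2 * s := by
      have hbL := hφL0 b hb
      rw [hδ, div_pow, ← huL, hus]
      simp only [map_mul, map_pow, map_ofNat]
      field_simp
    obtain ⟨k, hk⟩ := exists_algebraMap_eq_of_fixed hg (x := (2 * (y : L) - 1) * δ) (by
      rw [map_mul, hδg, map_sub, map_mul, map_one, map_ofNat]
      linear_combination (-2 * δ) * hyL)
    have hk2 : k ^ 2 = 2 * s * (1 - 4 * n) := by
      apply (algebraMap QuadK L).injective
      rw [map_pow, hk, map_mul, map_mul, map_sub, map_mul, hyN]
      simp only [map_ofNat, map_intCast, map_one]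
      linear_combination ((2 * (y : L) - 1) ^ 2) * hδ2
    have hki : IsIntegral ℤ k := by
      refine IsIntegral.of_pow (n := 2) (by norm_num) ?_
      have h5 : k ^ 2 = algebraMap (𝓞 QuadK) QuadK (2 * s * (1 - 4 * n)) := by
        rw [hk2, map_mul, map_mul, map_sub, map_mul, map_ofNat, map_ofNat, map_intCast, map_one]
      rw [h5]
      exact NumberField.RingOfIntegers.isIntegral_coe _
    obtain ⟨m, l, hml⟩ := quadK_exists_int hki
    obtain ⟨n₁, n₂, hn12⟩ := quadK_integer_eq n
    have hnK : (n : QuadK) = n₁ + n₂ * quadAlpha := by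
      rw [hn12]; simp
    have h6 := quadK_rat_eq (s := m ^ 2 - 5 * l ^ 2) (t := 2 * m * l) (s' := 2 * s * (1 - 4 * n₁))
      (t' := -8 * s * n₂) (by
        push_cast
        rw [hml, hnK] at hk2
        linear_combination hk2 - (l ^ 2 : QuadK) * quadAlpha_sq)
    have h7 : m ^ 2 - 5 * l ^ 2 = 2 * s * (1 - 4 * n₁) := by exact_mod_cast h6.1
    obtain ⟨m', hm⟩ : ∃ m', m = 2 * m' + m % 2 := ⟨m / 2, by omega⟩
    obtain ⟨l', hl⟩ : ∃ l', l = 2 * l' + l % 2 := ⟨l / 2, by omega⟩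
    rcases hs with rfl | rfl <;>
    rcases Int.emod_two_eq_zero_or_one m with h8 | h8 <;>
    rcases Int.emod_two_eq_zero_or_one l with h9 | h9 <;>
    · rw [h8] at hm
      rw [h9] at hl
      rw [hm, hl] at h7
      ring_nf at h7
      omega

/-! `K₁` is the Hilbert class field -/

theorem exists_dual_apply_ne_zero {K V : Type*} [Field K] [AddCommGroup V] [Module K V] {v : V}
    (hv : v ≠ 0) : ∃ f : V →ₗ[K] K, f v ≠ 0 := by
  by_contra! hall
  exact hv ((Module.forall_dual_apply_eq_zero_iff K v).mp hall)

theorem exists_addMonoidHom_zmod_apply_ne_zero {V : Type*} [AddCommGroup V] {q : ℕ}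
    (hq : q.Prime) (hkill : ∀ x : V, q • x = 0) {v : V} (hv : v ≠ 0) :
    ∃ φ : V →+ ZMod q, φ v ≠ 0 := by
  have : Fact q.Prime := ⟨hq⟩
  let inst : @Module (ZMod q) V (ZMod.instField q).toSemiring _ := AddCommGroup.zmodModule hkill
  obtain ⟨f, hf⟩ := exists_dual_apply_ne_zero (K := ZMod q) hv
  exact ⟨f.toAddMonoidHom, hf⟩

theorem exists_subgroup_index_eq_prime {G : Type*} [CommGroup G] [Finite G] {q : ℕ} (hq : q.Prime)
    (h : q ∣ Nat.card G) : ∃ H : Subgroup G, H.index = q := by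
  have : Fact q.Prime := ⟨hq⟩
  set P := (powMonoidHom (α := G) q).range with hP
  have hPtop : P ≠ ⊤ := by
    intro htop
    have hsurj : Function.Surjective (powMonoidHom (α := G) q) := MonoidHom.range_eq_top.mp htop
    have hinj := Finite.injective_iff_surjective.mpr hsurj
    obtain ⟨x, hx⟩ := exists_prime_orderOf_dvd_card' q h
    have h1 : x = 1 := hinj (by simp [← hx, pow_orderOf_eq_one])
    rw [h1, orderOf_one] at hx
    exact hq.one_lt.ne hx
  have hkill : ∀ x : Additive (G ⧸ P), q • x = 0 := by
    intro x
    obtain ⟨y, hy⟩ := QuotientGroup.mk_surjective x.toMul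
    have : (y : G ⧸ P) ^ q = 1 := by
      rw [← QuotientGroup.mk_pow, QuotientGroup.eq_one_iff]
      exact ⟨y, rfl⟩
    rw [hy] at this
    exact this
  obtain ⟨x, hx⟩ : ∃ x : G, x ∉ P := by
    by_contra! hall
    exact hPtop (Subgroup.eq_top_iff' _ |>.mpr hall)
  have hv : (Additive.ofMul (x : G ⧸ P)) ≠ 0 := by
    intro h0
    exact hx ((QuotientGroup.eq_one_iff x).mp h0)
  obtain ⟨φ, hφ⟩ := exists_addMonoidHom_zmod_apply_ne_zero hq hkill hv
  let ψ : G →* Multiplicative (ZMod q) :=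
    (AddMonoidHom.toMultiplicativeRight φ).comp (QuotientGroup.mk' P)
  refine ⟨ψ.ker, ?_⟩
  have hcard : Nat.card (Multiplicative (ZMod q)) = q := by simp
  have hrange : ψ.range = ⊤ := by
    have : Fact (Nat.card (Multiplicative (ZMod q))).Prime := ⟨by rw [hcard]; exact hq⟩
    refine (ψ.range.eq_bot_or_eq_top_of_prime_card).resolve_left fun hbot => hφ ?_
    have : ψ x ∈ ψ.range := ⟨x, rfl⟩
    rw [hbot, Subgroup.mem_bot] at this
    exact this
  rw [Subgroup.index_ker, hrange, Subgroup.card_top, hcard]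

open scoped IsMulCommutative in
theorem exists_intermediateField_finrank_eq_prime {F M : Type*} [Field F] [Field M] [Algebra F M]
    [FiniteDimensional F M] [IsAbelianGalois F M] {q : ℕ} (hq : q.Prime)
    (h : q ∣ Module.finrank F M) : ∃ E : IntermediateField F M, Module.finrank F E = q := by
  rw [← IsGalois.card_aut_eq_finrank F M] at h
  obtain ⟨H, hH⟩ := exists_subgroup_index_eq_prime hq h
  refine ⟨IntermediateField.fixedField H, ?_⟩
  have h1 := Module.finrank_mul_finrank F (IntermediateField.fixedField H) M
  rw [IntermediateField.finrank_fixedField_eq_card, ← IsGalois.card_aut_eq_finrank F M,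
    ← H.index_mul_card, hH] at h1
  exact Nat.eq_of_mul_eq_mul_right Nat.card_pos h1

/-- `K₁` embeds into every extension of `K` that contains a square root of `-1`. -/
theorem exists_algHom_of_sq_eq_neg_one {M : Type*} [Field M] [Algebra QuadK M] {θ : M}
    (hθ : θ ^ 2 = -1) : Nonempty (QuartK →ₐ[QuadK] M) := by
  have : CharZero M := charZero_of_injective_algebraMap (algebraMap QuadK M).injective
  set a : M := algebraMap QuadK M quadAlpha with ha
  have ha2 : a ^ 2 = -5 := by rw [ha, ← map_pow, quadAlpha_sq, map_neg, map_ofNat]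
  let f : QuartK →+* M := AdjoinRoot.lift (f := (X ^ 4 + 12 * X ^ 2 + 16 : ℚ[X]))
    (algebraMap ℚ M) (θ + a) (by
      simp only [eval₂_add, eval₂_mul, eval₂_X_pow, eval₂_ofNat]
      have h1 : (θ + a) ^ 2 = -6 + 2 * a * θ := by linear_combination hθ + ha2
      linear_combination ((θ + a) ^ 2 + 6 + 2 * a * θ) * h1 + 4 * θ ^ 2 * ha2 - 20 * hθ)
  have hf : f quartBeta = θ + a :=
    AdjoinRoot.lift_root (f := (X ^ 4 + 12 * X ^ 2 + 16 : ℚ[X])) (i := algebraMap ℚ M) _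
  have hcomp : f.comp (algebraMap QuadK QuartK) = algebraMap QuadK M := by
    apply quadK_ext_ringHom
    rw [RingHom.comp_apply, algebraMap_quadAlpha, ← ha]
    unfold quartAlpha
    simp only [map_div₀, map_add, map_mul, map_pow, map_ofNat, hf]
    field_simp
    linear_combination (θ + 3 * a) * hθ + (3 * θ + a) * ha2
  exact ⟨{ f with commutes' := fun r => congrArg (fun g => g r) hcomp }⟩

theorem finrank_eq_one_of_abelian_unramified_quartK {M : Type} [Field M] [NumberField M]
    [Algebra QuartK M] [IsAbelianGalois QuartK M] [Algebra.FormallyUnramified (𝓞 QuartK) (𝓞 M)]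
    {k : ℕ} (hk : Module.finrank QuartK M ∣ 2 ^ k) : Module.finrank QuartK M = 1 := by
  obtain ⟨l, -, hl⟩ := (Nat.dvd_prime_pow Nat.prime_two).mp hk
  rcases Nat.eq_zero_or_pos l with rfl | hpos
  · rw [hl, pow_zero]
  obtain ⟨E, hE⟩ := exists_intermediateField_finrank_eq_prime (F := QuartK) (M := M) Nat.prime_two
    (by rw [hl]; exact dvd_pow_self 2 hpos.ne')
  have := formallyUnramified_tower_bot QuartK E M
  exact absurd hE finrank_ne_two_of_unramified_quartK

theorem nonempty_algHom_of_isAbelianUnramified (M : Type) [Field M] [NumberField M]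
    [Algebra QuadK M] (h : IsAbelianUnramified QuadK M) : Nonempty (M →ₐ[QuadK] QuartK) := by
  have := h.isAbelianGalois
  have hu : Algebra.FormallyUnramified (𝓞 QuadK) (𝓞 M) :=
    formallyUnramified_of_forall_ne_bot QuadK M h.isUnramifiedAt
  have key : ∀ q, q.Prime → q ∣ Module.finrank QuadK M → ∃ E : IntermediateField QuadK M,
      Module.finrank QuadK E = q ∧ Algebra.FormallyUnramified (𝓞 QuadK) (𝓞 E) := fun q hq hd => by
    obtain ⟨E, hE⟩ := exists_intermediateField_finrank_eq_prime (F := QuadK) (M := M) hq hd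
    exact ⟨E, hE, formallyUnramified_tower_bot QuadK E M⟩
  rcases Nat.eq_two_pow_or_exists_odd_prime_and_dvd (Module.finrank QuadK M) with
    ⟨k, hk⟩ | ⟨q, hq, hd, hodd⟩
  swap
  · obtain ⟨E, hE, _⟩ := key q hq hd
    exact absurd hE (finrank_ne_odd_prime_of_unramified hq (by rintro rfl; revert hodd; decide))
  rcases Nat.eq_zero_or_pos k with rfl | hpos
  · rw [pow_zero] at hk
    have hb : Function.Bijective (algebraMap QuadK M) :=
      Algebra.finrank_eq_one_iff_bijective_algebraMap.mp hk
    exact ⟨(Algebra.ofId QuadK QuartK).comp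
      (AlgEquiv.ofBijective (Algebra.ofId QuadK M) hb).symm.toAlgHom⟩
  obtain ⟨E, hE, _⟩ := key 2 Nat.prime_two (by rw [hk]; exact dvd_pow_self 2 hpos.ne')
  obtain ⟨θ, hθ⟩ := exists_sq_eq_neg_one_of_unramified hE
  obtain ⟨f⟩ := exists_algHom_of_sq_eq_neg_one (M := M) (θ := (θ : M))
    (by rw [← IntermediateField.coe_pow, hθ]; rfl)
  let _ : Algebra QuartK M := f.toRingHom.toAlgebra
  have : IsScalarTower QuadK QuartK M := IsScalarTower.of_algebraMap_eq' f.comp_algebraMap.symm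
  have : IsAbelianGalois QuartK M := IsAbelianGalois.tower_top QuadK QuartK M
  have := formallyUnramified_tower_top QuadK QuartK M
  have h1 : Module.finrank QuartK M = 1 :=
    finrank_eq_one_of_abelian_unramified_quartK (k := k)
      (by rw [← hk, ← Module.finrank_mul_finrank QuadK QuartK M]; exact Dvd.intro_left _ rfl)
  have hb : Function.Bijective f :=
    Algebra.finrank_eq_one_iff_bijective_algebraMap.mp h1
  exact ⟨(AlgEquiv.ofBijective f hb).symm.toAlgHom⟩

theorem isHilbertClassField_quartK : IsHilbertClassField QuadK QuartK where
  isAbelianUnramified := isAbelianUnramified_quadK_quartK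
  maximal M _ _ _ h := nonempty_algHom_of_isAbelianUnramified M h

theorem IsHilbertClassField.nonempty_algEquiv {H : Type} [Field H] [NumberField H]
    [Algebra QuadK H] (h : IsHilbertClassField QuadK H) : Nonempty (H ≃ₐ[QuadK] QuartK) := by
  obtain ⟨f⟩ := h.maximal QuartK isAbelianUnramified_quadK_quartK
  obtain ⟨g⟩ := nonempty_algHom_of_isAbelianUnramified H h.isAbelianUnramified
  have h1 := LinearMap.finrank_le_finrank_of_injective (f := f.toLinearMap) f.toRingHom.injective
  have hb : Function.Bijective g :=
    ⟨g.toRingHom.injective, (LinearMap.injective_iff_surjective_of_finrank_eq_finrank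
      (f := g.toLinearMap) (le_antisymm (LinearMap.finrank_le_finrank_of_injective
        (f := g.toLinearMap) g.toRingHom.injective) h1)).mp g.toRingHom.injective⟩
  exact ⟨AlgEquiv.ofBijective g hb⟩

/-! Conjugacy of matrices -/

theorem conjugateOver_iff {R : Type*} [CommRing R] {n : ℕ} {M N : Matrix (Fin n) (Fin n) ℤ} :
    ConjugateOver R M N ↔ ∃ C : Matrix (Fin n) (Fin n) R, IsUnit C.det ∧
      M.map (Int.castRingHom R) * C = C * N.map (Int.castRingHom R) := by
  constructor
  · rintro ⟨C, hC⟩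
    refine ⟨C, (Matrix.isUnit_iff_isUnit_det _).mp C.isUnit, ?_⟩
    rw [← hC, ← mul_assoc, ← mul_assoc, C.mul_inv, one_mul]
  · rintro ⟨C, hdet, hC⟩
    obtain ⟨D, rfl⟩ := (Matrix.isUnit_iff_isUnit_det _).mpr hdet
    exact ⟨D, by rw [mul_assoc, hC, ← mul_assoc, D.inv_mul, one_mul]⟩

theorem ConjugateOver.trans {R : Type*} [CommRing R] {n : ℕ} {L M N : Matrix (Fin n) (Fin n) ℤ}
    (h : ConjugateOver R L M) (h' : ConjugateOver R M N) : ConjugateOver R L N := by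
  obtain ⟨C, hC⟩ := h
  obtain ⟨D, hD⟩ := h'
  refine ⟨C * D, ?_⟩
  rw [← hD, ← hC]
  simp only [mul_inv_rev, Units.val_mul, mul_assoc]

theorem ConjugateOver.symm {R : Type*} [CommRing R] {n : ℕ} {M N : Matrix (Fin n) (Fin n) ℤ}
    (h : ConjugateOver R M N) : ConjugateOver R N M := by
  obtain ⟨C, hC⟩ := h
  refine ⟨C⁻¹, ?_⟩
  rw [← hC, inv_inv, mul_assoc, mul_assoc, mul_assoc, C.mul_inv, mul_one, ← mul_assoc, C.mul_inv,
    one_mul]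

theorem conjugateOver_matA_matB_iff {R : Type*} [CommRing R] :
    ConjugateOver R matA matB ↔ ∃ a b : R, IsUnit (2 * a ^ 2 + 2 * a * b + 3 * b ^ 2) := by
  rw [conjugateOver_iff]
  constructor
  · rintro ⟨C, hdet, hC⟩
    refine ⟨C 0 0, C 0 1, ?_⟩
    have h0 := congrFun (congrFun hC 0) 0
    have h1 := congrFun (congrFun hC 0) 1
    simp [matA, matB, Matrix.mul_apply, Fin.sum_univ_two] at h0 h1
    rw [Matrix.det_fin_two, h0, h1] at hdet
    convert hdet using 1
    ring
  · rintro ⟨a, b, h⟩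
    refine ⟨!![a, b; -a - 3 * b, 2 * a + b], ?_, ?_⟩
    · rw [Matrix.det_fin_two_of]
      convert h using 1
      ring
    · ext i j
      fin_cases i <;> fin_cases j <;>
        simp [matA, matB, Matrix.mul_apply, Fin.sum_univ_two] <;> ring

theorem not_conjugateOver_int_matA_matB : ¬ ConjugateOver ℤ matA matB := by
  rw [conjugateOver_matA_matB_iff]
  rintro ⟨a, b, h⟩
  have hsq : 2 * (2 * a ^ 2 + 2 * a * b + 3 * b ^ 2) = (2 * a + b) ^ 2 + 5 * b ^ 2 := by ring
  rcases Int.isUnit_iff.mp h with h | h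
  · rw [h] at hsq
    have hb : b = 0 := by
      have : b ^ 2 < 1 := by nlinarith [sq_nonneg (2 * a + b)]
      nlinarith [sq_nonneg b, Int.abs_lt_one_iff.mp ((sq_lt_one_iff_abs_lt_one b).mp this)]
    rw [hb] at h
    omega
  · nlinarith [sq_nonneg (2 * a + b), sq_nonneg b]

theorem locallyConjugate_matA_matB : LocallyConjugate matA matB := by
  intro p hp
  rw [conjugateOver_matA_matB_iff]
  have key : ∀ n : ℤ, ¬ (p : ℤ) ∣ n → IsUnit (n : ℤ_[p]) := by
    intro n hn
    rw [PadicInt.isUnit_iff]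
    refine le_antisymm (PadicInt.norm_le_one _) (not_lt.mp fun h => hn ?_)
    exact (PadicInt.norm_int_lt_one_iff_dvd n).mp h
  by_cases h2 : p = 2
  · refine ⟨0, 1, ?_⟩
    have := key 3 (by rw [h2]; decide)
    simpa using this
  · refine ⟨1, 0, ?_⟩
    have := key 2 (fun h => h2 ?_)
    · simpa using this
    · exact (Nat.prime_dvd_prime_iff_eq hp.out Nat.prime_two).mp (by exact_mod_cast h)

theorem matA_mem : matA ∈ matricesWithCharpoly 2 (X ^ 2 + 5) := by
  change matA.charpoly = _
  rw [Matrix.charpoly_fin_two]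
  simp [matA, Matrix.trace_fin_two, Matrix.det_fin_two]

theorem matB_mem : matB ∈ matricesWithCharpoly 2 (X ^ 2 + 5) := by
  change matB.charpoly = _
  rw [Matrix.charpoly_fin_two]
  simp [matB, Matrix.trace_fin_two, Matrix.det_fin_two]

theorem eq_of_mem_matricesWithCharpoly {M : Matrix (Fin 2) (Fin 2) ℤ}
    (h : M ∈ matricesWithCharpoly 2 (X ^ 2 + 5)) :
    ∃ r s t : ℤ, M = !![r, s; t, -r] ∧ r ^ 2 + s * t = -5 := by
  change M.charpoly = _ at h
  rw [Matrix.charpoly_fin_two] at h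
  have h0 := congrArg (Polynomial.eval 0) h
  have h1 := congrArg (Polynomial.eval 1) h
  simp [Matrix.trace_fin_two, Matrix.det_fin_two] at h0 h1
  have h11 : M 1 1 = -M 0 0 := by linarith
  refine ⟨M 0 0, M 0 1, M 1 0, ?_, ?_⟩
  · ext i j
    fin_cases i <;> fin_cases j <;> simp [h11]
  · rw [h11] at h0
    linarith

theorem conjugateOver_int_shear (r s t k : ℤ) :
    ConjugateOver ℤ !![r, s; t, -r] !![r + k * s, s; t - 2 * k * r - k ^ 2 * s, -(r + k * s)] := by
  rw [conjugateOver_iff]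
  refine ⟨!![1, 0; k, 1], by simp [Matrix.det_fin_two], ?_⟩
  ext i j
  fin_cases i <;> fin_cases j <;> simp [Matrix.mul_apply, Fin.sum_univ_two] <;> ring

theorem conjugateOver_int_swap (r s t : ℤ) :
    ConjugateOver ℤ !![r, s; t, -r] !![-r, -t; -s, - -r] := by
  rw [conjugateOver_iff]
  refine ⟨!![0, 1; -1, 0], by simp [Matrix.det_fin_two], ?_⟩
  ext i j
  fin_cases i <;> fin_cases j <;> simp [Matrix.mul_apply, Fin.sum_univ_two]

theorem conjugateOver_int_neg (r s t : ℤ) :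
    ConjugateOver ℤ !![r, s; t, -r] !![r, -s; -t, -r] := by
  rw [conjugateOver_iff]
  refine ⟨!![1, 0; 0, -1], by simp [Matrix.det_fin_two], ?_⟩
  ext i j
  fin_cases i <;> fin_cases j <;> simp [Matrix.mul_apply, Fin.sum_univ_two]

theorem conjugateOver_int_of_small {r s t : ℤ} (h : r ^ 2 + s * t = -5) (hr : 2 * |r| ≤ s)
    (hs : s ≤ 2) (hs0 : 0 < s) :
    ConjugateOver ℤ !![r, s; t, -r] matA ∨ ConjugateOver ℤ !![r, s; t, -r] matB := by
  have hrs := abs_le.mp (show |r| ≤ 1 by omega)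
  obtain ⟨hr1, hr2⟩ := hrs
  obtain rfl | rfl : s = 1 ∨ s = 2 := by omega
  · left
    have hr0 : r = 0 := by
      rw [← abs_eq_zero]
      have := abs_nonneg r
      omega
    subst hr0
    obtain rfl : t = -5 := by linarith
    rw [conjugateOver_iff]
    exact ⟨1, by simp, by simp [matA]⟩
  · right
    obtain rfl | rfl | rfl : r = -1 ∨ r = 0 ∨ r = 1 := by omega
    · obtain rfl : t = -3 := by omega
      rw [conjugateOver_iff]
      exact ⟨1, by simp, by simp [matB]⟩
    · omega
    · obtain rfl : t = -3 := by omega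
      have := conjugateOver_int_shear 1 2 (-3) (-1)
      norm_num at this
      exact this

theorem conjugateOver_int_matA_or_matB {r s t : ℤ} (h : r ^ 2 + s * t = -5) :
    ConjugateOver ℤ !![r, s; t, -r] matA ∨ ConjugateOver ℤ !![r, s; t, -r] matB := by
  induction hn : s.natAbs using Nat.strong_induction_on generalizing r s t with
  | _ n ih =>
  have reduce : ∀ r' s' t' : ℤ, ConjugateOver ℤ !![r, s; t, -r] !![r', s'; t', -r'] →
      (ConjugateOver ℤ !![r', s'; t', -r'] matA ∨ ConjugateOver ℤ !![r', s'; t', -r'] matB) →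
      ConjugateOver ℤ !![r, s; t, -r] matA ∨ ConjugateOver ℤ !![r, s; t, -r] matB :=
    fun r' s' t' h1 h2 => h2.imp h1.trans h1.trans
  have hs : s ≠ 0 := by
    rintro rfl
    nlinarith [sq_nonneg r]
  obtain ⟨k, hk⟩ : ∃ k : ℤ, 2 * |r + k * s| ≤ |s| := by
    refine ⟨-round ((r : ℚ) / s), ?_⟩
    have h1 := abs_sub_round ((r : ℚ) / s)
    have h2 : (r : ℚ) + ((-round ((r : ℚ) / s) : ℤ) : ℚ) * s =
        s * ((r : ℚ) / s - round ((r : ℚ) / s)) := by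
      have : (s : ℚ) ≠ 0 := by exact_mod_cast hs
      field_simp
      push_cast
      ring
    have h3 : 2 * |(r : ℚ) + ((-round ((r : ℚ) / s) : ℤ) : ℚ) * s| ≤ |(s : ℚ)| := by
      rw [h2, abs_mul]
      nlinarith [abs_nonneg (s : ℚ)]
    exact_mod_cast h3
  set r' := r + k * s with hr'
  set t' := t - 2 * k * r - k ^ 2 * s with ht'
  have h' : r' ^ 2 + s * t' = -5 := by rw [hr', ht']; linear_combination h
  refine reduce r' s t' (conjugateOver_int_shear r s t k) ?_
  rcases lt_or_ge |t'| |s| with hlt | hge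
  · rw [Int.abs_eq_natAbs, Int.abs_eq_natAbs] at hlt
    have := ih (-t').natAbs (by omega) (r := -r') (s := -t') (t := -s) (by linarith) rfl
    exact this.imp (conjugateOver_int_swap r' s t').trans (conjugateOver_int_swap r' s t').trans
  · have hst : |s| * |t'| = r' ^ 2 + 5 := by
      rw [← abs_mul, show s * t' = -(r' ^ 2 + 5) by linarith, abs_neg, abs_of_pos (by positivity)]
    have hs2 : |s| ≤ 2 := by
      by_contra! hcon
      nlinarith [sq_abs r', abs_nonneg r', abs_nonneg s]
    rcases lt_or_gt_of_ne hs with hneg | hpos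
    · rw [abs_of_neg hneg] at hs2 hk
      have := conjugateOver_int_of_small (r := r') (s := -s) (t := -t') (by linarith) hk hs2
        (by omega)
      exact this.imp (conjugateOver_int_neg r' s t').trans (conjugateOver_int_neg r' s t').trans
    · rw [abs_of_pos hpos] at hs2 hk
      exact conjugateOver_int_of_small h' hk hs2 hpos

theorem xor_conjugateOver_int {M : Matrix (Fin 2) (Fin 2) ℤ}
    (h : M ∈ matricesWithCharpoly 2 (X ^ 2 + 5)) :
    Xor (ConjugateOver ℤ M matA) (ConjugateOver ℤ M matB) := by
  obtain ⟨r, s, t, rfl, hrst⟩ := eq_of_mem_matricesWithCharpoly h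
  rcases conjugateOver_int_matA_or_matB hrst with h1 | h1
  · exact Or.inl ⟨h1, fun h2 => not_conjugateOver_int_matA_matB (h1.symm.trans h2)⟩
  · exact Or.inr ⟨h1, fun h2 => not_conjugateOver_int_matA_matB (h2.symm.trans h1)⟩

theorem matA_mulVec : (matA.map (Int.castRingHom QuadK)).mulVec ![1, quadAlpha] =
    quadAlpha • ![1, quadAlpha] := by
  have h := quadAlpha_sq
  ext i
  fin_cases i <;> simp [matA, Matrix.mulVec, dotProduct, Fin.sum_univ_two]
  linear_combination -h

theorem matB_mulVec : (matB.map (Int.castRingHom QuadK)).mulVec ![2, 1 + quadAlpha] =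
    quadAlpha • ![2, 1 + quadAlpha] := by
  have h := quadAlpha_sq
  ext i
  fin_cases i <;> simp [matB, Matrix.mulVec, dotProduct, Fin.sum_univ_two]
  · ring
  · linear_combination -h

/-! Non-conjugacy over the ring of integers of `K₁` -/

/-- The automorphism `i ↦ -i`, `φ ↦ φ` of the ring of integers of `K₁`. -/
noncomputable def intConj : 𝓞 QuartK →+* 𝓞 QuartK := NumberField.RingOfIntegers.mapRingHom quartConj

theorem intConj_intI : intConj intI = -intI := by
  apply NumberField.RingOfIntegers.ext
  exact quartConj_I

theorem intConj_intPhi : intConj intPhi = intPhi := by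
  apply NumberField.RingOfIntegers.ext
  exact quartConj_Phi

theorem intConj_apply (a b c d : ℤ) :
    intConj (((a : 𝓞 QuartK) + b * intI) + (c + d * intI) * intPhi) =
      (a - b * intI) + (c - d * intI) * intPhi := by
  simp only [map_add, map_mul, map_intCast, intConj_intI, intConj_intPhi]
  ring

theorem intConj_intConj (x : 𝓞 QuartK) : intConj (intConj x) = x := by
  obtain ⟨a, b, c, d, rfl⟩ := quartK_integer_eq x
  have h := intConj_apply a (-b) c (-d)
  push_cast at h
  rw [intConj_apply]
  convert h using 2 <;> ring

/-- A unit of absolute value `1` that is `1` modulo `2` is `± 1`. -/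
theorem eq_one_or_eq_neg_one_of_mul_intConj {q : 𝓞 QuartK}
    (h : (1 + 2 * q) * intConj (1 + 2 * q) = 1) : 1 + 2 * q = 1 ∨ 1 + 2 * q = -1 := by
  obtain ⟨a, b, c, d, hq⟩ := quartK_integer_eq q
  have hc : intConj q = (a - b * intI) + (c - d * intI) * intPhi := by rw [hq, intConj_apply]
  rw [map_add, map_one, map_mul, map_ofNat, hc, hq] at h
  have h4 : (4 : 𝓞 QuartK) * (((a ^ 2 + c ^ 2 + a + b ^ 2 + d ^ 2 : ℤ) + (0 : ℤ) * intI) +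
      ((2 * a * c + c ^ 2 + c + 2 * b * d + d ^ 2 : ℤ) + (0 : ℤ) * intI) * intPhi) = 0 := by
    push_cast
    linear_combination h + (4 * (b + d * intPhi) ^ 2) * intI_sq -
      4 * (c ^ 2 + d ^ 2) * intPhi_sq
  obtain ⟨h1, -, h2, -⟩ := quartK_integer_eq_zero
    ((mul_eq_zero.mp h4).resolve_left (by norm_num))
  have hsum : (2 * a + 1 + 2 * c) ^ 2 + (2 * a + 1) ^ 2 + 8 * c ^ 2 +
      4 * ((b + d) ^ 2 + b ^ 2 + 2 * d ^ 2) = 2 := by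
    linear_combination 8 * h1 + 4 * h2
  have hzero : ∀ n : ℤ, n ^ 2 < 1 → n = 0 := fun n hn =>
    Int.abs_lt_one_iff.mp ((sq_lt_one_iff_abs_lt_one n).mp hn)
  have hc0 : c = 0 := hzero c (by
    linarith [sq_nonneg (2 * a + 1 + 2 * c), sq_nonneg (2 * a + 1), sq_nonneg (b + d),
      sq_nonneg b, sq_nonneg d])
  have hd0 : d = 0 := hzero d (by
    linarith [sq_nonneg (2 * a + 1 + 2 * c), sq_nonneg (2 * a + 1), sq_nonneg (b + d),
      sq_nonneg b, sq_nonneg c])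
  have hb0 : b = 0 := hzero b (by
    linarith [sq_nonneg (2 * a + 1 + 2 * c), sq_nonneg (2 * a + 1), sq_nonneg (b + d),
      sq_nonneg c, sq_nonneg d])
  subst hc0 hd0 hb0
  have ha : a * (a + 1) = 0 := by linarith
  rw [hq]
  rcases mul_eq_zero.mp ha with ha | ha
  · left
    simp [ha]
  · right
    rw [eq_neg_of_add_eq_zero_left ha]
    push_cast
    ring

/-- The form `2 a² + 2 a b + 3 b²` represents no unit of the ring of integers of `K₁`. -/
theorem not_isUnit_two_mul_sq_add (a b : 𝓞 QuartK) :
    ¬ IsUnit (2 * a ^ 2 + 2 * a * b + 3 * b ^ 2) := by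
  intro h
  have hi := intI_sq
  have hφ := intPhi_sq
  set x := (1 - intI) * a + (-intI + (1 + intI) * intPhi) * b with hx
  set y := (1 - intI) * a + (1 - (1 + intI) * intPhi) * b with hy
  have hxy : intI * (x * y) = 2 * a ^ 2 + 2 * a * b + 3 * b ^ 2 := by
    rw [hx, hy]
    linear_combination ((-2 + intI) * a ^ 2 + (intI - 2) * a * b +
      (-1 + 2 * intPhi + intPhi * intI - (2 + intI) * intPhi ^ 2) * b ^ 2) * hi + 2 * b ^ 2 * hφ
  have hu : IsUnit (x * y) := isUnit_of_mul_isUnit_right (hxy ▸ h)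
  obtain ⟨x', hx'⟩ := (isUnit_of_mul_isUnit_left hu).exists_right_inv
  obtain ⟨y', hy'⟩ := (isUnit_of_mul_isUnit_right hu).exists_right_inv
  set s := (1 + intI) * b * y' with hs
  set t := intI * (-a - b + intPhi * b) * y' with ht
  set u := x * y' with hu
  set v := y * x' with hv
  have huv : u * v = 1 := by rw [hu, hv]; linear_combination x * x' * hy' + hx'
  have hus : u = 1 + (2 * intPhi - 1) * s := by
    rw [hu, hs, hx]
    rw [hy] at hy'
    linear_combination hy'
  have hut : u = intI + 2 * t := by
    rw [hu, ht, hx]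
    rw [hy] at hy'
    linear_combination intI * hy' + y' * (a + b * intPhi) * hi
  clear_value u v s t
  have huv' : intConj u * intConj v = 1 := by rw [← map_mul, huv, map_one]
  have hut' : intConj u = -intI + 2 * intConj t := by
    rw [hut, map_add, map_mul, map_ofNat, intConj_intI]
  have hq : 1 + 2 * (intConj v * (intI + t - intConj t)) = u * intConj v := by
    linear_combination -huv' - intConj v * hut + intConj v * hut'
  rcases eq_one_or_eq_neg_one_of_mul_intConj (q := intConj v * (intI + t - intConj t)) (by
    rw [hq, map_mul, intConj_intConj]
    linear_combination intConj v * intConj u * huv + huv') with h1 | h1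
  · have hreal : u = intConj u := by
      rw [hq] at h1
      linear_combination intConj u * h1 - u * huv'
    obtain ⟨k, l, m, n, hklmn⟩ := quartK_integer_eq t
    rw [hut', hut, hklmn, intConj_apply] at hreal
    have := quartK_integer_eq_zero (a := 0) (b := 2 * (1 + 2 * l)) (c := 0) (d := 4 * n) (by
      push_cast
      linear_combination hreal)
    omega
  · have hanti : u = -intConj u := by
      rw [hq] at h1
      linear_combination intConj u * h1 - u * huv'
    obtain ⟨k, l, m, n, hklmn⟩ := quartK_integer_eq s
    have hus' : intConj u = 1 + (2 * intPhi - 1) * intConj s := by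
      rw [hus, map_add, map_one, map_mul, map_sub, map_mul, map_ofNat, map_one, intConj_intPhi]
    rw [hus', hus, hklmn, intConj_apply] at hanti
    have := quartK_integer_eq_zero (a := 2 * (1 - k + 2 * m)) (b := 0) (c := 2 * (2 * k + m))
      (d := 0) (by
      push_cast
      linear_combination hanti - 4 * m * hφ)
    omega

theorem not_conjugateOver_quartK : ¬ ConjugateOver (𝓞 QuartK) matA matB := by
  rw [conjugateOver_matA_matB_iff]
  rintro ⟨a, b, h⟩
  exact not_isUnit_two_mul_sq_add a b h

theorem not_solvesConjugacyExtension {H : Type} [Field H] [NumberField H] [Algebra QuadK H]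
    (h : IsHilbertClassField QuadK H) : ¬ SolvesConjugacyExtension 2 (X ^ 2 + 5) (𝓞 H) := by
  intro hsolve
  obtain ⟨e⟩ := h.nonempty_algEquiv
  have h1 := hsolve matA matA_mem matB matB_mem locallyConjugate_matA_matB
  rw [conjugateOver_matA_matB_iff] at h1
  obtain ⟨a, b, hab⟩ := h1
  let f : 𝓞 H →+* 𝓞 QuartK := NumberField.RingOfIntegers.mapRingHom e
  have h2 := hab.map f
  simp only [map_add, map_mul, map_pow, map_ofNat] at h2
  exact not_isUnit_two_mul_sq_add _ _ h2

/-! The module `R ⊗ I` -/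

theorem two_mem_idealI : (2 : QuadK) ∈ idealI := Submodule.subset_span (by simp)

theorem one_add_alpha_mem_idealI : 1 + quadAlpha ∈ idealI := Submodule.subset_span (by simp)

theorem diagEmb_two : diagEmb 2 = (2, 2) := by
  rw [map_ofNat]
  rfl

theorem diagEmb_one_add_alpha : diagEmb (1 + quadAlpha) = (1 + quartAlpha, 1 - quartAlpha) := by
  change (embPos (1 + quadAlpha), embNeg (1 + quadAlpha)) = _
  rw [map_add, map_add, map_one, map_one, embPos_alpha, embNeg_alpha, sub_eq_add_neg]

theorem exists_tensor_eq (z : 𝓞 QuartK ⊗[ℤ] idealI) : ∃ r s : 𝓞 QuartK,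
    z = r ⊗ₜ ⟨2, two_mem_idealI⟩ + s ⊗ₜ ⟨1 + quadAlpha, one_add_alpha_mem_idealI⟩ := by
  induction z using TensorProduct.induction_on with
  | zero => exact ⟨0, 0, by simp⟩
  | tmul r y =>
    obtain ⟨y, hy⟩ := y
    obtain ⟨m, n, rfl⟩ := Submodule.mem_span_pair.mp hy
    refine ⟨m • r, n • r, ?_⟩
    rw [TensorProduct.smul_tmul, TensorProduct.smul_tmul, ← TensorProduct.tmul_add]
    rfl
  | add z w hz hw =>
    obtain ⟨r, s, rfl⟩ := hz
    obtain ⟨r', s', rfl⟩ := hw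
    refine ⟨r + r', s + s', ?_⟩
    rw [TensorProduct.add_tmul, TensorProduct.add_tmul]
    abel

theorem tensorMap_apply (r s : 𝓞 QuartK) :
    tensorMap (r ⊗ₜ ⟨2, two_mem_idealI⟩ + s ⊗ₜ ⟨1 + quadAlpha, one_add_alpha_mem_idealI⟩) =
      r • ((2, 2) : QuartK × QuartK) + s • (1 + quartAlpha, 1 - quartAlpha) := by
  rw [← diagEmb_two, ← diagEmb_one_add_alpha, map_add]
  rfl

theorem quartAlpha_ne_zero : quartAlpha ≠ 0 := by
  intro h
  have := quartAlpha_sq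
  rw [h] at this
  norm_num at this

theorem eq_zero_of_smul_add_smul_eq_zero {r s : 𝓞 QuartK}
    (h : r • ((2, 2) : QuartK × QuartK) + s • (1 + quartAlpha, 1 - quartAlpha) = 0) :
    r = 0 ∧ s = 0 := by
  obtain ⟨h1, h2⟩ := Prod.ext_iff.mp h
  simp only [Prod.fst_add, Prod.smul_fst, Prod.snd_add, Prod.smul_snd, Prod.fst_zero,
    Prod.snd_zero, Algebra.smul_def] at h1 h2
  have hinj := FaithfulSMul.algebraMap_injective (𝓞 QuartK) QuartK
  have hs : algebraMap (𝓞 QuartK) QuartK s = 0 := by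
    have : algebraMap (𝓞 QuartK) QuartK s * (2 * quartAlpha) = 0 := by linear_combination h1 - h2
    exact (mul_eq_zero.mp this).resolve_right (mul_ne_zero two_ne_zero quartAlpha_ne_zero)
  have hr : algebraMap (𝓞 QuartK) QuartK r = 0 := by
    rw [hs] at h1
    simpa using h1
  exact ⟨hinj (by rw [hr, map_zero]), hinj (by rw [hs, map_zero])⟩

theorem linearIndependent_pair : LinearIndependent (𝓞 QuartK)
    ![((2, 2) : QuartK × QuartK), (1 + quartAlpha, 1 - quartAlpha)] :=
  LinearIndependent.pair_iff.mpr fun _ _ h => eq_zero_of_smul_add_smul_eq_zero h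

theorem tensorMap_injective : Function.Injective tensorMap := by
  rw [injective_iff_map_eq_zero]
  intro z hz
  obtain ⟨r, s, rfl⟩ := exists_tensor_eq z
  rw [tensorMap_apply] at hz
  obtain ⟨rfl, rfl⟩ := eq_zero_of_smul_add_smul_eq_zero hz
  simp

theorem range_tensorMap : LinearMap.range tensorMap =
    Submodule.span (𝓞 QuartK) {((2, 2) : QuartK × QuartK), (1 + quartAlpha, 1 - quartAlpha)} := by
  ext z
  rw [Submodule.mem_span_pair, LinearMap.mem_range]
  constructor
  · rintro ⟨w, rfl⟩
    obtain ⟨r, s, rfl⟩ := exists_tensor_eq w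
    exact ⟨r, s, (tensorMap_apply r s).symm⟩
  · rintro ⟨r, s, rfl⟩
    exact ⟨_, tensorMap_apply r s⟩

theorem alpha_mul_fst : ((quartAlpha, -quartAlpha) : QuartK × QuartK) * (2, 2) =
    (-1 : 𝓞 QuartK) • ((2, 2) : QuartK × QuartK) +
      (2 : 𝓞 QuartK) • (1 + quartAlpha, 1 - quartAlpha) := by
  have h2 : algebraMap (𝓞 QuartK) QuartK 2 = 2 := map_ofNat _ 2
  ext <;> simp [Algebra.smul_def, h2] <;> ring

theorem alpha_mul_snd : ((quartAlpha, -quartAlpha) : QuartK × QuartK) *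
      (1 + quartAlpha, 1 - quartAlpha) =
    (-3 : 𝓞 QuartK) • ((2, 2) : QuartK × QuartK) +
      (1 : 𝓞 QuartK) • (1 + quartAlpha, 1 - quartAlpha) := by
  have h := quartAlpha_sq
  have h3 : algebraMap (𝓞 QuartK) QuartK 3 = 3 := map_ofNat _ 3
  ext <;> simp [Algebra.smul_def, h3] <;> linear_combination h

theorem alpha_mul_combination (a b : 𝓞 QuartK) : ((quartAlpha, -quartAlpha) : QuartK × QuartK) *
      (a • ((2, 2) : QuartK × QuartK) + b • (1 + quartAlpha, 1 - quartAlpha)) =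
    (-a - 3 * b) • ((2, 2) : QuartK × QuartK) +
      (2 * a + b) • (1 + quartAlpha, 1 - quartAlpha) := by
  rw [mul_add, mul_smul_comm, mul_smul_comm, alpha_mul_fst, alpha_mul_snd]
  module

theorem exists_eq_of_mem_ringRAlpha {c : QuartK × QuartK} (hc : c ∈ ringRAlpha) :
    ∃ x y : 𝓞 QuartK, c = x • (1 : QuartK × QuartK) + y • (quartAlpha, -quartAlpha) := by
  have hsq : ((quartAlpha, -quartAlpha) : QuartK × QuartK) * (quartAlpha, -quartAlpha) =
      (-5 : 𝓞 QuartK) • (1 : QuartK × QuartK) := by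
    have h := quartAlpha_sq
    have h5 : algebraMap (𝓞 QuartK) QuartK 5 = 5 := map_ofNat _ 5
    ext <;> simp [Algebra.smul_def, h5] <;> linear_combination h
  induction hc using Algebra.adjoin_induction with
  | mem c hc =>
    rw [Set.mem_singleton_iff.mp hc]
    exact ⟨0, 1, by simp⟩
  | algebraMap r => exact ⟨r, 0, by
    rw [zero_smul, add_zero]
    exact Algebra.algebraMap_eq_smul_one r⟩
  | add c d _ _ hc hd =>
    obtain ⟨x, y, rfl⟩ := hc
    obtain ⟨x', y', rfl⟩ := hd
    exact ⟨x + x', y + y', by module⟩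
  | mul c d _ _ hc hd =>
    obtain ⟨x, y, rfl⟩ := hc
    obtain ⟨x', y', rfl⟩ := hd
    refine ⟨x * x' - 5 * (y * y'), x * y' + y * x', ?_⟩
    simp only [mul_add, add_mul, smul_mul_assoc, mul_smul_comm, one_mul, mul_one, hsq]
    module

theorem mem_idealRI_iff {z : QuartK × QuartK} : z ∈ idealRI ↔
    ∃ r s : 𝓞 QuartK, r • ((2, 2) : QuartK × QuartK) + s • (1 + quartAlpha, 1 - quartAlpha) = z := by
  constructor
  · intro hz
    induction hz using Submodule.span_induction with
    | mem z hz =>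
      obtain ⟨y, hy, rfl⟩ := hz
      obtain ⟨m, n, rfl⟩ := Submodule.mem_span_pair.mp hy
      refine ⟨m, n, ?_⟩
      rw [map_add, map_zsmul, map_zsmul, diagEmb_two, diagEmb_one_add_alpha, Int.cast_smul_eq_zsmul,
        Int.cast_smul_eq_zsmul]
    | zero => exact ⟨0, 0, by simp⟩
    | add z w _ _ hz hw =>
      obtain ⟨r, s, rfl⟩ := hz
      obtain ⟨r', s', rfl⟩ := hw
      exact ⟨r + r', s + s', by module⟩
    | smul c z _ hz =>
      obtain ⟨r, s, rfl⟩ := hz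
      obtain ⟨x, y, hxy⟩ := exists_eq_of_mem_ringRAlpha c.2
      refine ⟨x * r + y * (-r - 3 * s), x * s + y * (2 * r + s), ?_⟩
      have hc : ∀ w : QuartK × QuartK, c • w = (c : QuartK × QuartK) * w := fun w => rfl
      rw [hc, hxy, add_mul, smul_mul_assoc, one_mul, smul_mul_assoc, alpha_mul_combination]
      module
  · rintro ⟨r, s, rfl⟩
    have h2 : ((2, 2) : QuartK × QuartK) ∈ idealRI.restrictScalars (𝓞 QuartK) :=
      Submodule.subset_span ⟨2, two_mem_idealI, diagEmb_two⟩
    have h1 : ((1 + quartAlpha, 1 - quartAlpha) : QuartK × QuartK) ∈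
        idealRI.restrictScalars (𝓞 QuartK) :=
      Submodule.subset_span ⟨1 + quadAlpha, one_add_alpha_mem_idealI, diagEmb_one_add_alpha⟩
    exact add_mem (Submodule.smul_mem _ r h2) (Submodule.smul_mem _ s h1)

theorem idealRI_restrictScalars : idealRI.restrictScalars (𝓞 QuartK) =
    Submodule.span (𝓞 QuartK) {((2, 2) : QuartK × QuartK), (1 + quartAlpha, 1 - quartAlpha)} := by
  ext z
  rw [Submodule.mem_span_pair, Submodule.restrictScalars_mem, mem_idealRI_iff]

theorem not_isPrincipal_idealRI : ¬ idealRI.IsPrincipal := by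
  rintro ⟨g, hg⟩
  obtain ⟨a, b, hab⟩ := mem_idealRI_iff.mp (hg ▸ Submodule.mem_span_singleton_self g)
  have key : ∀ r s : 𝓞 QuartK, ∃ x y : 𝓞 QuartK,
      x * a + y * (-a - 3 * b) = r ∧ x * b + y * (2 * a + b) = s := by
    intro r s
    have hmem : r • ((2, 2) : QuartK × QuartK) + s • (1 + quartAlpha, 1 - quartAlpha) ∈ idealRI :=
      mem_idealRI_iff.mpr ⟨r, s, rfl⟩
    rw [hg] at hmem
    obtain ⟨c, hc⟩ := Submodule.mem_span_singleton.mp hmem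
    obtain ⟨x, y, hxy⟩ := exists_eq_of_mem_ringRAlpha c.2
    have hc' : (c : QuartK × QuartK) * g = _ := hc
    rw [hxy, ← hab, add_mul, smul_mul_assoc, one_mul, smul_mul_assoc, alpha_mul_combination] at hc'
    have := eq_zero_of_smul_add_smul_eq_zero (r := x * a + y * (-a - 3 * b) - r)
      (s := x * b + y * (2 * a + b) - s) (by
        rw [← sub_eq_zero.mpr hc']
        module)
    exact ⟨x, y, sub_eq_zero.mp this.1, sub_eq_zero.mp this.2⟩
  obtain ⟨x, y, h1, h2⟩ := key 1 0
  obtain ⟨x', y', h3, h4⟩ := key 0 1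
  refine not_isUnit_two_mul_sq_add a b (IsUnit.of_mul_eq_one (x * y' - y * x') ?_)
  linear_combination (x' * b + y' * (2 * a + b)) * h1 - (x' * a + y' * (-a - 3 * b)) * h2 + h4

theorem mainTheorem2 :
    -- `A` and `B` represent the two `ℤ`-conjugacy classes with characteristic polynomial `x² + 5`
    matA ∈ matricesWithCharpoly 2 (X ^ 2 + 5) ∧ matB ∈ matricesWithCharpoly 2 (X ^ 2 + 5) ∧
    (∀ M ∈ matricesWithCharpoly 2 (X ^ 2 + 5),
      Xor (ConjugateOver ℤ M matA) (ConjugateOver ℤ M matB)) ∧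
    -- `A` belongs to `ℤ[α]` with basis `1, α`, and `B` belongs to `I` with basis `2, 1 + α`
    (matA.map (Int.castRingHom QuadK)).mulVec ![1, quadAlpha] = quadAlpha • ![1, quadAlpha] ∧
    (matB.map (Int.castRingHom QuadK)).mulVec ![2, 1 + quadAlpha] =
      quadAlpha • ![2, 1 + quadAlpha] ∧
    -- `A` and `B` are locally conjugate
    LocallyConjugate matA matB ∧
    -- `K₁` is the Hilbert class field of `K`
    IsHilbertClassField QuadK QuartK ∧
    -- `R ⊗ I = (2, 2) R ⊕ (1 + α, 1 - α) R` as a submodule of `K₁ × K₁`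
    Function.Injective tensorMap ∧
    LinearMap.range tensorMap = idealRI.restrictScalars (𝓞 QuartK) ∧
    idealRI.restrictScalars (𝓞 QuartK) =
      Submodule.span (𝓞 QuartK) {((2, 2) : QuartK × QuartK), (1 + quartAlpha, 1 - quartAlpha)} ∧
    LinearIndependent (𝓞 QuartK)
      ![((2, 2) : QuartK × QuartK), (1 + quartAlpha, 1 - quartAlpha)] ∧
    -- this `R[α]`-module is not principal
    ¬ idealRI.IsPrincipal ∧
    -- `A` and `B` are not conjugate over the ring of integers `R` of `K₁`
    ¬ ConjugateOver (𝓞 QuartK) matA matB ∧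
    -- the Hilbert class field of `K` does not solve the conjugacy extension problem
    (∀ (H : Type) [Field H] [NumberField H] [Algebra QuadK H], IsHilbertClassField QuadK H →
      ¬ SolvesConjugacyExtension 2 (X ^ 2 + 5) (𝓞 H)) :=
  ⟨matA_mem, matB_mem, fun _ => xor_conjugateOver_int, matA_mulVec, matB_mulVec,
    locallyConjugate_matA_matB, isHilbertClassField_quartK, tensorMap_injective,
    range_tensorMap.trans idealRI_restrictScalars.symm, idealRI_restrictScalars,
    linearIndependent_pair, not_isPrincipal_idealRI, not_conjugateOver_quartK,
    fun _ _ _ _ => not_solvesConjugacyExtension⟩
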